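/- Fix $d\in\mathbb N$ and let $\mathcal G^d$ be the set of finite simple graphs of maximum degree at most $d$, up to isomorphism. For $K>0$, a $K$-weighted graph is a pair $(G,p)$ with $G\in\mathcal G^d$ and $p:V(G)\to(0,\infty)$ a probability distribution such that $\frac1K\le \frac{p(v)}{p(w)}\le K$ for all adjacent $v,w$. For $K$-weighted graphs $(G,p)$, $(H,q)$ on the same vertex set put $$\mathrm{dist}_K((G,p),(H,q))=\sum_{uv\in E(G)\setminus E(H)}\bigl(p(u)+p(v)\bigr)+\sum_{uv\in E(H)\setminus E(G)}\bigl(q(u)+q(v)\bigr),$$ and for $\mathcal P\subseteq\mathcal G^d$ let $\mathrm{dist}_K((G,p),\mathcal P)$ be the infimum of $\mathrm{dist}_K((G,p),(H,q))$ over all $K$-weighted graphs $(H,q)$ on the vertex set of $G$ with $H\in\mathcal P$ (it is $\infty$ if there are none). The Radon–Nikodym oracle of radius $r$ and depth $t$, queried at a vertex $x$ of $(G,p)$, returns the isomorphism class of the ball $B_r(G,x)$, rooted at $x$, in which every vertex $y$ is labelled by $p(y)/p(x)$ truncated after $t$ decimal digits. The set $\mathcal B^{d,r,K,t}$ of all possible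 answers on $K$-weighted graphs is finite. A property $\mathcal P\subseteq\mathcal G^d$ is *testable in constant time with a Radon–Nikodym oracle* in a class $\mathcal G\subseteq\mathcal G^d$ for any reasonable unknown vertex distribution if for all $\varepsilon>0$ and $K>0$ there are positive integers $t,r,C$ and a decision rule $(\mathcal B^{d,r,K,t})^C\to\{\text{ACCEPT},\text{REJECT}\}$ such that for every $K$-weighted graph $(G,p)$ with $G\in\mathcal G$, when the oracle is queried at $C$ vertices chosen independently according to $p$ and the rule is applied to the $C$ answers: * if $G\in\mathcal P$, then $G$ is always accepted; * if $\mathrm{dist}_K((G,p),\mathcal P)>\varepsilon$, then $G$ is rejected with probability more than $1-\varepsilon$. A class $\mathcal G$ of finite graphs has *Property A* if for all $\varepsilon>0$ and $R\in\mathbb N$ there is $S\in\mathbb N$ such that for every $G\in\mathcal G$ there are non-empty finite sets $A_x\subseteq B_S(G,x)\times\mathbb N$ $(x\in V(G))$ with $|A_x\triangle A_y|<\varepsilon\,|A_x\cap A_y|$ whenever $x,y$ are at distance at most $R$ in $G$. **Theorem.** Let $\mathcal P\subseteq\mathcal G^d$ be closed under taking (not necessarily induced) subgraphs and under disjoint unions.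 Then $\mathcal P$ is testable in constant time with a Radon–Nikodym oracle, for any reasonable unknown vertex distribution, in the class of planar graphs of maximum degree at most $d$, and, more generally, in every class $\mathcal G\subseteq\mathcal G^d$ that has Property A. -/

import Mathlib

/-- The set `𝒢^d`: finite simple graphs all of whose vertex degrees are at most `d`. -/
structure FiniteGraph (d : ℕ) where
  V : Type
  [fintypeV : Fintype V]
  graph : SimpleGraph V
  degree_le : ∀ v, (graph.neighborSet v).ncard ≤ d

attribute [instance] FiniteGraph.fintypeV

/-- `p` is a strictly positive probability distribution on the vertices of `G` whose ratio on
adjacent vertices lies between `1 / K` and `K`; that is, `(G, p)` is a `K`-weighted graph. -/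
structure IsKWeighting {V : Type} [Fintype V] (G : SimpleGraph V) (K : ℝ) (p : V → ℝ) : Prop where
  pos : ∀ v, 0 < p v
  sum_eq_one : ∑ v, p v = 1
  ratio : ∀ v w, G.Adj v w → 1 / K ≤ p v / p w ∧ p v / p w ≤ K

/-! ### Reasonable graph properties -/

/-- A set of graphs is reasonable if it is closed under taking (not necessarily induced)
subgraphs and under disjoint unions. As graphs are considered up to isomorphism, a subgraph of `G`
is any graph that has an injective homomorphism into `G`; in particular the set is invariant under
isomorphisms. -/
structure IsReasonable {d : ℕ} (P : Set (FiniteGraph d)) : Prop where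
  subgraph : ∀ G H : FiniteGraph d, G ∈ P → H.graph.IsContained G.graph → H ∈ P
  disjUnion : ∀ G₁ G₂ H : FiniteGraph d, G₁ ∈ P → G₂ ∈ P →
    Nonempty (H.graph ≃g G₁.graph.sum G₂.graph) → H ∈ P

/-! ### The weighted edit distance -/

/-- The weight `p u + p v` of an edge with endpoints `u`, `v`. -/
def edgeWeight {V : Type} (p : V → ℝ) : Sym2 V → ℝ :=
  Sym2.lift ⟨fun u v => p u + p v, fun u v => add_comm (p u) (p v)⟩

open scoped Classical in
/-- The weighted edit distance of `(G, p)` and `(H, q)`: edges of `G` that are not in `H` are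
weighted by `p`, edges of `H` that are not in `G` are weighted by `q`. -/
noncomputable def editDist {V : Type} [Fintype V] (G : SimpleGraph V) (p : V → ℝ)
    (H : SimpleGraph V) (q : V → ℝ) : ℝ :=
  (∑ e : Sym2 V with e ∈ G.edgeSet \ H.edgeSet, edgeWeight p e) +
    ∑ f : Sym2 V with f ∈ H.edgeSet \ G.edgeSet, edgeWeight q f

/-- The `K`-weighted edit distance of `(G, p)` from `P`: the infimum over all `K`-weighted graphs
`(H, q)` on the vertex set of `G` with `H ∈ P` (it is `∞` if there are none). -/
noncomputable def distToProperty {d : ℕ} (K : ℝ) (G : FiniteGraph d) (p : G.V → ℝ)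
    (P : Set (FiniteGraph d)) : ENNReal :=
  ⨅ (H : SimpleGraph G.V) (hd : ∀ v, (H.neighborSet v).ncard ≤ d)
    (_ : (⟨G.V, H, hd⟩ : FiniteGraph d) ∈ P) (q : G.V → ℝ) (_ : IsKWeighting H K q),
    ENNReal.ofReal (editDist G.graph p H q)

/-! ### The Radon-Nikodym oracle -/

/-- A rooted graph with a natural number written on each vertex. -/
structure RootedLabelledGraph where
  V : Type
  graph : SimpleGraph V
  root : V
  label : V → ℕ

/-- Isomorphism of rooted labelled graphs. -/
def RootedLabelledGraph.Isomorphic (A B : RootedLabelledGraph) : Prop :=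
  ∃ φ : A.graph ≃g B.graph, φ A.root = B.root ∧ ∀ v, B.label (φ v) = A.label v

instance RootedLabelledGraph.setoid : Setoid RootedLabelledGraph where
  r := RootedLabelledGraph.Isomorphic
  iseqv :=
    { refl := fun A => ⟨SimpleGraph.Iso.refl, rfl, fun _ => rfl⟩
      symm := by
        rintro A B ⟨φ, h, hl⟩
        refine ⟨φ.symm, ?_, fun v => ?_⟩
        · rw [← h]; exact φ.symm_apply_apply _
        · rw [← hl]; exact congrArg B.label (φ.apply_symm_apply v)
      trans := by
        rintro A B C ⟨φ, h, hl⟩ ⟨ψ, h', hl'⟩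
        refine ⟨ψ.comp φ, ?_, fun v => ?_⟩
        · rw [← h', ← h]; rfl
        · rw [← hl, ← hl']; rfl }

/-- Rooted labelled graphs up to isomorphism. -/
def RootedLabelledClass : Type 1 := Quotient RootedLabelledGraph.setoid

/-- The ball of radius `r` around `x` in `G`, rooted at `x`, in which the label of `y` is the
relative probability `p y / p x` truncated after `t` decimal digits and stored as the natural
number `⌊10 ^ t * (p y / p x)⌋`. -/
noncomputable def labelledBall {V : Type} (G : SimpleGraph V) (p : V → ℝ) (r t : ℕ) (x : V) :
    RootedLabelledGraph where
  V := {y : V // G.edist x y ≤ r}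
  graph := G.induce {y : V | G.edist x y ≤ r}
  root := ⟨x, by simp⟩
  label y := ⌊(10 : ℝ) ^ t * (p y.1 / p x)⌋₊

/-- The set `ℬ^{d,r,K,t}` of all possible results (up to isomorphism) of a query of the
Radon-Nikodym oracle with radius `r` and depth `t` on `K`-weighted graphs of degree bound `d`. -/
def oracleBalls (d r : ℕ) (K : ℝ) (t : ℕ) : Set RootedLabelledClass :=
  {B | ∃ (G : FiniteGraph d) (p : G.V → ℝ), IsKWeighting G.graph K p ∧
    ∃ x : G.V, B = Quotient.mk _ (labelledBall G.graph p r t x)}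

/-- The result of querying the Radon-Nikodym oracle with radius `r` and depth `t` at `x`. -/
noncomputable def oracle {d : ℕ} {K : ℝ} (G : FiniteGraph d) (p : G.V → ℝ)
    (hp : IsKWeighting G.graph K p) (r t : ℕ) (x : G.V) : oracleBalls d r K t :=
  ⟨Quotient.mk _ (labelledBall G.graph p r t x), G, p, hp, x, rfl⟩

open scoped Classical in
/-- The probability of an event `E` when `C` vertices are chosen independently according to `p`. -/
noncomputable def sampleProb {V : Type} [Fintype V] (p : V → ℝ) {C : ℕ} (E : (Fin C → V) → Prop) :
    ℝ :=
  ∑ x : Fin C → V with E x, ∏ i, p (x i)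

/-- `P` is testable in constant time with a Radon-Nikodym oracle in the class `𝒢` for any reasonable
unknown vertex distribution. The number `C` of queries, their radius `r` and depth `t`, and the
decision rule `accepts`, which sees nothing but `C` elements of the finite set `ℬ^{d,r,K,t}`, are
all fixed before the graph and the distribution. -/
def IsTestable {d : ℕ} (𝒢 P : Set (FiniteGraph d)) : Prop :=
  ∀ ε : ℝ, 0 < ε → ∀ K : ℝ, 0 < K →
    ∃ t r C : ℕ, 0 < t ∧ 0 < r ∧ 0 < C ∧ (oracleBalls d r K t).Finite ∧
      ∃ accepts : (Fin C → oracleBalls d r K t) → Prop,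
        ∀ G ∈ 𝒢, ∀ (p : G.V → ℝ) (hp : IsKWeighting G.graph K p),
          (G ∈ P → ∀ x : Fin C → G.V, accepts fun i => oracle G p hp r t (x i)) ∧
          (ENNReal.ofReal ε < distToProperty K G p P →
            1 - ε < sampleProb p fun x : Fin C → G.V =>
              ¬ accepts fun i => oracle G p hp r t (x i))

/-! ### Planar graphs and Property A -/

/-- `G` can be drawn in the plane: the vertices are distinct points, each edge is a simple
continuous arc that joins its two endpoints and contains no other vertex, and the arcs of distinct
edges meet at most in common endpoints. -/
def IsPlanar {V : Type} (G : SimpleGraph V) : Prop :=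
  ∃ (pt : V → ℝ × ℝ) (arc : G.edgeSet → C(unitInterval, ℝ × ℝ)),
    Function.Injective pt ∧
    (∀ e, Function.Injective (arc e)) ∧
    (∀ e : G.edgeSet, s(arc e 0, arc e 1) = Sym2.map pt e) ∧
    (∀ (e : G.edgeSet) (s : unitInterval) (v : V), arc e s = pt v → v ∈ (e : Sym2 V)) ∧
    (∀ (e f : G.edgeSet) (s s' : unitInterval), e ≠ f → arc e s = arc f s' →
      ∃ v : V, v ∈ (e : Sym2 V) ∧ v ∈ (f : Sym2 V) ∧ arc e s = pt v)

/-- The class of planar graphs of degree bound `d`. -/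
def planarGraphs (d : ℕ) : Set (FiniteGraph d) := {G | IsPlanar G.graph}

open scoped Classical in
/-- Yu's Property A for a class of finite graphs with their path metrics, uniformly over the class
(equivalently: for the coarse disjoint union of the class). -/
def HasPropertyA {d : ℕ} (𝒢 : Set (FiniteGraph d)) : Prop :=
  ∀ ε : ℝ, 0 < ε → ∀ R : ℕ, ∃ S : ℕ, ∀ G ∈ 𝒢,
    ∃ A : G.V → Finset (G.V × ℕ),
      (∀ x, (A x).Nonempty) ∧
      (∀ x, ∀ a ∈ A x, G.graph.edist x a.1 ≤ S) ∧
      ∀ x y, G.graph.edist x y ≤ R →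
        ((symmDiff (A x) (A y)).card : ℝ) < ε * ((A x ∩ A y).card : ℝ)

/-! The tester ignores all labels: it accepts when every sampled ball, as a plain graph, is
contained in a member of `P`. Balls of a graph in `P` are subgraphs of it, so such a graph always
passes.

Soundness rests on hyperfiniteness for arbitrary positive vertex weights: deleting edges of small
weight leaves pieces of bounded diameter in the metric of `G`. Call a vertex bad if its ball is in
no member of `P`. A piece with a good vertex lies in that vertex's ball; a piece of bad vertices
only is dissolved into isolated vertices at cost at most `d` times its weight. Closure under
subgraphs and disjoint unions puts the result in `P`, so a graph far from `P` has bad vertices of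
total weight bounded below, and boundedly many samples probably hit one
(`IsHyperfinite.exists_ball_bound`, `IsHyperfinite.isTestable`).

For Property A, the sets `A x` become almost invariant integer distributions of equal mass.
Averaging over their superlevel sets gives a set of bounded diameter with small weighted boundary,
and such sets are peeled off one by one (`exists_small_boundary`, `exists_clustering`).

For planar graphs, the vertices are cut into bands of distance layers, twice, with shifts chosen by
averaging. A surviving component of large diameter would yield a `K₃,₃` minor, as in the
Klein–Plotkin–Rao argument (`edist_le_of_reachable_bandGraph`). Planarity excludes that minor by a
parity count of winding numbers (`not_exists_K33_drawing`). -/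

/-! ### Variation of the logarithm and drawings of `K₃,₃` in the plane -/

/-- `Δ` is the increment, from `0` to `1`, of a continuous logarithm of `f`. -/
def IsLogVariation (f : ℝ → ℂ) (Δ : ℂ) : Prop :=
  ∃ L : ℝ → ℂ, Continuous L ∧ (∀ t, Complex.exp (L t) = f t) ∧ L 1 - L 0 = Δ

theorem exists_continuous_log {X : Type*} [TopologicalSpace X] [SimplyConnectedSpace X]
    [LocallyPathConnectedSpace X] {F : X → ℂ} (hc : Continuous F) (hF : ∀ x, F x ≠ 0) :
    ∃ L : X → ℂ, Continuous L ∧ ∀ x, Complex.exp (L x) = F x := by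
  obtain ⟨x₀⟩ : Nonempty X := inferInstance
  obtain ⟨L, ⟨-, hL⟩, -⟩ := Complex.isCoveringMapOn_exp.existsUnique_continuousMap_lifts
    ⟨F, hc⟩ (a₀ := x₀) (Complex.exp_log (hF x₀)) (fun x => hF x)
  exact ⟨L, L.continuous, fun x => congrFun hL x⟩

theorem IsLogVariation.exists {f : ℝ → ℂ} (hc : Continuous f) (hf : ∀ t, f t ≠ 0) :
    ∃ Δ, IsLogVariation f Δ := by
  obtain ⟨L, hL, h⟩ := exists_continuous_log hc hf
  exact ⟨_, L, hL, h, rfl⟩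

/-- Two continuous logarithms differ by an integer multiple of `2πi` that depends continuously on
the parameter, hence is constant. -/
theorem IsLogVariation.unique {f : ℝ → ℂ} {Δ Δ' : ℂ} (h : IsLogVariation f Δ)
    (h' : IsLogVariation f Δ') : Δ = Δ' := by
  obtain ⟨L, hL, hLf, rfl⟩ := h
  obtain ⟨L', hL', hLf', rfl⟩ := h'
  have hn : ∀ t, ∃ n : ℤ, L t = L' t + n * (2 * Real.pi * Complex.I) := fun t =>
    Complex.exp_eq_exp_iff_exists_int.1 ((hLf t).trans (hLf' t).symm)
  choose n hn using hn
  have hpi : (2 * Real.pi * Complex.I : ℂ) ≠ 0 := Complex.two_pi_I_ne_zero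
  have hcn : Continuous fun t => ((n t : ℤ) : ℂ) := by
    have : (fun t => ((n t : ℤ) : ℂ)) = fun t => (L t - L' t) / (2 * Real.pi * Complex.I) := by
      funext t
      rw [eq_div_iff hpi, hn t]
      ring
    rw [this]
    fun_prop
  have hcn' : Continuous n := by
    have hre : Continuous fun t => ((n t : ℤ) : ℝ) := by
      simpa [Function.comp_def] using Complex.continuous_re.comp hcn
    exact Int.isClosedEmbedding_coe_real.isEmbedding.continuous_iff.2 hre
  have : n 1 = n 0 := PreconnectedSpace.constant inferInstance hcn'
  rw [hn 1, hn 0, this]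
  ring

theorem IsLogVariation.neg {f g : ℝ → ℂ} {Δ : ℂ} (h : IsLogVariation f Δ)
    (hg : ∀ t, g t = -f t) : IsLogVariation g Δ := by
  obtain ⟨L, hL, hLf, rfl⟩ := h
  refine ⟨fun t => L t + Real.pi * Complex.I, by fun_prop, fun t => ?_, by ring⟩
  rw [Complex.exp_add, Complex.exp_pi_mul_I, hLf, hg]
  ring

theorem IsLogVariation.exists_int {f : ℝ → ℂ} {Δ ℓ₀ ℓ₁ : ℂ} (h : IsLogVariation f Δ)
    (h₀ : Complex.exp ℓ₀ = f 0) (h₁ : Complex.exp ℓ₁ = f 1) :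
    ∃ n : ℤ, Δ = ℓ₁ - ℓ₀ + n * (2 * Real.pi * Complex.I) := by
  obtain ⟨L, hL, hLf, rfl⟩ := h
  obtain ⟨m, hm⟩ := Complex.exp_eq_exp_iff_exists_int.1 ((hLf 0).trans h₀.symm)
  obtain ⟨k, hk⟩ := Complex.exp_eq_exp_iff_exists_int.1 ((hLf 1).trans h₁.symm)
  refine ⟨k - m, ?_⟩
  rw [hm, hk]
  push_cast
  ring

/-- The logarithm of `γ s - δ t` has no monodromy around the boundary of the square. -/
theorem IsLogVariation.square {γ δ : ℝ → ℂ} (hγ : Continuous γ) (hδ : Continuous δ)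
    (hne : ∀ s t, γ s ≠ δ t) {Δ₁ Δ₂ Δ₃ Δ₄ : ℂ}
    (h₁ : IsLogVariation (fun s => γ s - δ 0) Δ₁) (h₂ : IsLogVariation (fun t => δ t - γ 1) Δ₂)
    (h₃ : IsLogVariation (fun t => δ t - γ 0) Δ₃) (h₄ : IsLogVariation (fun s => γ s - δ 1) Δ₄) :
    Δ₁ + Δ₂ = Δ₃ + Δ₄ := by
  -- The difference vanishes nowhere on the plane, so a single logarithm serves all four sides of
  -- the square; passing from `f` to `-f` leaves a variation unchanged.
  obtain ⟨L, hL, hLf⟩ := exists_continuous_log (X := ℝ × ℝ) (F := fun x => γ x.1 - δ x.2)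
    (by fun_prop) (fun x => sub_ne_zero.2 (hne _ _))
  have e₁ := h₁.unique ⟨fun s => L (s, 0), by fun_prop, fun s => hLf _, rfl⟩
  have e₄ := h₄.unique ⟨fun s => L (s, 1), by fun_prop, fun s => hLf _, rfl⟩
  have e₂ := (h₂.neg (g := fun t => γ 1 - δ t) (fun t => by ring)).unique
    ⟨fun t => L (1, t), by fun_prop, fun t => hLf _, rfl⟩
  have e₃ := (h₃.neg (g := fun t => γ 0 - δ t) (fun t => by ring)).unique
    ⟨fun t => L (0, t), by fun_prop, fun t => hLf _, rfl⟩
  rw [e₁, e₂, e₃, e₄]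
  ring

/-- A chosen logarithm of `R v - R w`. -/
noncomputable def pairLog (R : Fin 6 → ℂ) (v w : Fin 6) : ℂ :=
  if v < w then Complex.log (R v - R w) else Complex.log (R w - R v) + Real.pi * Complex.I

theorem exp_pairLog {R : Fin 6 → ℂ} {v w : Fin 6} (h : R v ≠ R w) :
    Complex.exp (pairLog R v w) = R v - R w := by
  unfold pairLog
  split_ifs
  · exact Complex.exp_log (sub_ne_zero.2 h)
  · rw [Complex.exp_add, Complex.exp_pi_mul_I, Complex.exp_log (sub_ne_zero.2 h.symm)]
    ring

/-- The logarithms for the two orders of a pair differ by exactly `πi`, with a sign read off from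
the indices. Only these signs survive in the relation around a square; the positions of the points
cancel. -/
theorem pairLog_swap (R : Fin 6 → ℂ) {v w : Fin 6} (h : v ≠ w) :
    pairLog R w v = pairLog R v w + ((if v < w then 1 else -1 : ℤ) : ℂ) * (Real.pi * Complex.I) := by
  unfold pairLog
  rcases lt_or_gt_of_ne h with h | h
  · simp [h, h.not_gt]
  · simp [h, h.not_gt]

/-- The vertices of one side of `K₃,₃`; the two sides alternate. -/
def leftVertex (i : Fin 3) : Fin 6 := ⟨2 * i, by omega⟩

/-- The vertices of the other side of `K₃,₃`; the two sides alternate. -/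
def rightVertex (j : Fin 3) : Fin 6 := ⟨2 * j + 1, by omega⟩

/-- `K₃,₃` cannot be drawn in the plane in such a way that independent edges do not meet. -/
theorem not_exists_K33_drawing (R : Fin 6 → ℂ) (γ : Fin 3 → Fin 3 → ℝ → ℂ)
    (hc : ∀ i j, Continuous (γ i j)) (h0 : ∀ i j, γ i j 0 = R (leftVertex i))
    (h1 : ∀ i j, γ i j 1 = R (rightVertex j))
    (hne : ∀ i j i' j', i ≠ i' → j ≠ j' → ∀ s t, γ i j s ≠ γ i' j' t) : False := by
  have avoidL : ∀ i j i', i ≠ i' → ∀ s, γ i j s ≠ R (leftVertex i') := by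
    intro i j i' hi s
    -- Every vertex off an edge is an endpoint of some edge independent of it, so the edge avoids
    -- that vertex.
    obtain ⟨j', hj⟩ : ∃ j' : Fin 3, j ≠ j' := ⟨j + 1, by fin_cases j <;> decide⟩
    rw [← h0 i' j']
    exact hne i j i' j' hi hj s 0
  have avoidR : ∀ i j j', j ≠ j' → ∀ s, γ i j s ≠ R (rightVertex j') := by
    intro i j j' hj s
    obtain ⟨i', hi⟩ : ∃ i' : Fin 3, i ≠ i' := ⟨i + 1, by fin_cases i <;> decide⟩
    rw [← h1 i' j']
    exact hne i j i' j' hi hj s 1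
  have avoid : ∀ i j w, w ≠ leftVertex i → w ≠ rightVertex j → ∀ s, γ i j s ≠ R w := by
    intro i j w hwl hwr
    have : (∃ i', w = leftVertex i') ∨ ∃ j', w = rightVertex j' := by
      clear hwl hwr
      revert w
      decide
    rcases this with ⟨i', rfl⟩ | ⟨j', rfl⟩
    · exact avoidL i j i' fun h => hwl (h ▸ rfl)
    · exact avoidR i j j' fun h => hwr (h ▸ rfl)
  have hn : ∀ i j w, ∃ n : ℤ, w ≠ leftVertex i → w ≠ rightVertex j →
      IsLogVariation (fun s => γ i j s - R w)
        (pairLog R (rightVertex j) w - pairLog R (leftVertex i) w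
          + n * (2 * Real.pi * Complex.I)) := by
    intro i j w
    by_cases hwl : w = leftVertex i
    · exact ⟨0, fun h => absurd hwl h⟩
    by_cases hwr : w = rightVertex j
    · exact ⟨0, fun _ h => absurd hwr h⟩
    have hav := avoid i j w hwl hwr
    obtain ⟨Δ, hΔ⟩ := IsLogVariation.exists (f := fun s => γ i j s - R w)
      (by have := hc i j; fun_prop) (fun s => sub_ne_zero.2 (hav s))
    obtain ⟨n, rfl⟩ := hΔ.exists_int (ℓ₀ := pairLog R (leftVertex i) w)
      (ℓ₁ := pairLog R (rightVertex j) w)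
      (by simp only [h0]; exact exp_pairLog (by rw [← h0 i j]; exact hav 0))
      (by simp only [h1]; exact exp_pairLog (by rw [← h1 i j]; exact hav 1))
    exact ⟨n, fun _ _ => hΔ⟩
  choose n hn using hn
  -- The square relation for two independent edges, divided by `πi`. The four signs compare cyclic
  -- neighbours in the sequence of the left vertices `i`, `i'` and the right vertices `j`, `j'`.
  -- Their sum is `±2` if the two chords interlace on the hexagon and `0` otherwise.
  have key : ∀ i j i' j', i ≠ i' → j ≠ j' →
      (if leftVertex i' < rightVertex j then 1 else -1 : ℤ)
      + (if leftVertex i < leftVertex i' then 1 else -1 : ℤ)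
      + (if rightVertex j < rightVertex j' then 1 else -1 : ℤ)
      + (if rightVertex j' < leftVertex i then 1 else -1 : ℤ)
      + 2 * (n i j (leftVertex i') + n i' j' (rightVertex j)
        - n i' j' (leftVertex i) - n i j (rightVertex j')) = 0 := by
    intro i j i' j' hi hj
    have ll : ∀ i i', i ≠ i' → leftVertex i ≠ leftVertex i' := by decide
    have rr : ∀ j j', j ≠ j' → rightVertex j ≠ rightVertex j' := by decide
    have lr : ∀ i j, leftVertex i ≠ rightVertex j := by decide
    have v₁ := hn i j (leftVertex i') (ll _ _ hi.symm) (lr _ _)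
    have v₂ := hn i' j' (rightVertex j) (lr _ _).symm (rr _ _ hj)
    have v₃ := hn i' j' (leftVertex i) (ll _ _ hi) (lr _ _)
    have v₄ := hn i j (rightVertex j') (lr _ _).symm (rr _ _ hj.symm)
    rw [← h0 i' j'] at v₁
    rw [← h1 i j] at v₂
    rw [← h0 i j] at v₃
    rw [← h1 i' j'] at v₄
    have hsq := IsLogVariation.square (hc i j) (hc i' j') (hne i j i' j' hi hj) v₁ v₂ v₃ v₄
    rw [pairLog_swap R (lr i' j), pairLog_swap R (ll i i' hi), pairLog_swap R (rr j j' hj),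
      pairLog_swap R (lr i j').symm] at hsq
    have hpi : (Real.pi * Complex.I : ℂ) ≠ 0 := by
      simp [Real.pi_ne_zero]
    refine Int.cast_injective (α := ℂ) (mul_right_cancel₀ hpi ?_)
    rw [Int.cast_zero, zero_mul, ← sub_eq_zero.2 hsq]
    push_cast
    ring
  have l01 : (0 : Fin 3) ≠ 1 := by decide
  have l02 : (0 : Fin 3) ≠ 2 := by decide
  have l12 : (1 : Fin 3) ≠ 2 := by decide
  have a₁ := key 0 0 1 1 l01 l01
  have a₂ := key 0 0 1 2 l01 l02
  have a₃ := key 0 1 1 0 l01 l01.symm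
  have a₄ := key 0 1 1 2 l01 l12
  have a₅ := key 0 2 1 0 l01 l02.symm
  have a₆ := key 0 2 1 1 l01 l12.symm
  have b₁ := key 0 0 2 1 l02 l01
  have b₂ := key 0 0 2 2 l02 l02
  have b₃ := key 0 1 2 0 l02 l01.symm
  have b₄ := key 0 1 2 2 l02 l12
  have b₅ := key 0 2 2 0 l02 l02.symm
  have b₆ := key 0 2 2 1 l02 l12.symm
  have c₁ := key 1 0 2 1 l12 l01
  have c₂ := key 1 0 2 2 l12 l02
  have c₃ := key 1 1 2 0 l12 l01.symm
  have c₄ := key 1 1 2 2 l12 l12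
  have c₅ := key 1 2 2 0 l12 l02.symm
  have c₆ := key 1 2 2 1 l12 l12.symm
  simp [leftVertex, rightVertex] at a₁ a₂ a₃ a₄ a₅ a₆ b₁ b₂ b₃ b₄ b₅ b₆ c₁ c₂ c₃ c₄ c₅ c₆
  -- Halve the 18 equations and add them modulo 2. Each winding number occurs in exactly two of them
  -- and drops out, while the only interlacing pairs are those among the three long diagonals of the
  -- hexagon: three, an odd number.
  omega

/-- Six disjoint connected branch sets that contract to `K₃,₃`. -/
structure IsK33Minor {V : Type*} (G : SimpleGraph V) (A B : Fin 3 → Set V) : Prop where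
  nonempty_left : ∀ i, (A i).Nonempty
  nonempty_right : ∀ j, (B j).Nonempty
  preconnected_left : ∀ i, (G.induce (A i)).Preconnected
  preconnected_right : ∀ j, (G.induce (B j)).Preconnected
  disjoint_left : ∀ i i', i ≠ i' → Disjoint (A i) (A i')
  disjoint_right : ∀ j j', j ≠ j' → Disjoint (B j) (B j')
  disjoint : ∀ i j, Disjoint (A i) (B j)
  exists_adj : ∀ i j, ∃ a ∈ A i, ∃ b ∈ B j, G.Adj a b

/-- The part of a plane drawing that belongs to the subgraph induced on `S`. -/
def drawnPart {V : Type*} {G : SimpleGraph V} (pt : V → ℝ × ℝ)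
    (arc : G.edgeSet → C(unitInterval, ℝ × ℝ)) (S : Set V) : Set (ℝ × ℝ) :=
  {z | (∃ v ∈ S, z = pt v) ∨ ∃ e : G.edgeSet, (∀ v ∈ (e : Sym2 V), v ∈ S) ∧ ∃ s, z = arc e s}

theorem joinedIn_drawnPart {V : Type*} {G : SimpleGraph V} {pt : V → ℝ × ℝ}
    {arc : G.edgeSet → C(unitInterval, ℝ × ℝ)}
    (hend : ∀ e : G.edgeSet, s(arc e 0, arc e 1) = Sym2.map pt e) {S : Set V} (u v : S)
    (h : (G.induce S).Reachable u v) : JoinedIn (drawnPart pt arc S) (pt u) (pt v) := by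
  rw [SimpleGraph.reachable_iff_reflTransGen] at h
  induction h with
  | refl => exact JoinedIn.refl (Or.inl ⟨u, u.2, rfl⟩)
  | @tail b c _ hbc ih =>
    refine ih.trans ?_
    let e : G.edgeSet := ⟨s(b.1, c.1), hbc⟩
    have hmem : ∀ s, arc e s ∈ drawnPart pt arc S := fun s => Or.inr ⟨e, by
      intro v hv
      rcases Sym2.mem_iff.1 hv with rfl | rfl
      exacts [b.2, c.2], s, rfl⟩
    have hj : JoinedIn (drawnPart pt arc S) (arc e 0) (arc e 1) :=
      ⟨⟨arc e, rfl, rfl⟩, hmem⟩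
    have he : s(arc e 0, arc e 1) = s(pt b, pt c) := hend e
    rcases Sym2.eq_iff.1 he with ⟨h0, h1⟩ | ⟨h0, h1⟩
    · rwa [h0, h1] at hj
    · rw [h0, h1] at hj
      exact hj.symm

/-- Drawn arcs and vertices meet only at vertices incident to both or along one and the same edge,
so a common point would always produce a vertex of `S ∩ T`. -/
theorem disjoint_drawnPart {V : Type*} {G : SimpleGraph V} {pt : V → ℝ × ℝ}
    {arc : G.edgeSet → C(unitInterval, ℝ × ℝ)} (hpt : Function.Injective pt)
    (hav : ∀ (e : G.edgeSet) (s : unitInterval) (v : V), arc e s = pt v → v ∈ (e : Sym2 V))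
    (hint : ∀ (e f : G.edgeSet) (s s' : unitInterval), e ≠ f → arc e s = arc f s' →
      ∃ v : V, v ∈ (e : Sym2 V) ∧ v ∈ (f : Sym2 V) ∧ arc e s = pt v)
    {S T : Set V} (hST : Disjoint S T) : Disjoint (drawnPart pt arc S) (drawnPart pt arc T) := by
  have hd : ∀ v, v ∈ S → v ∈ T → False := fun v hS hT => Set.disjoint_left.1 hST hS hT
  refine Set.disjoint_left.2 ?_
  rintro z (⟨v, hv, rfl⟩ | ⟨e, he, s, rfl⟩) (⟨w, hw, hz⟩ | ⟨f, hf, s', hz⟩)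
  · exact hd v hv (hpt hz ▸ hw)
  · exact hd v hv (hf v (hav f s' v hz.symm))
  · exact hd w (he w (hav e s w hz)) hw
  · by_cases hef : e = f
    · subst hef
      obtain ⟨v, hv⟩ : ∃ v, v ∈ (e : Sym2 V) := ⟨_, (e : Sym2 V).out_fst_mem⟩
      exact hd v (he v hv) (hf v hv)
    · obtain ⟨v, hve, hvf, -⟩ := hint e f s s' hef hz
      exact hd v (he v hve) (hf v hvf)

theorem IsK33Minor.preconnected_union {V : Type*} {G : SimpleGraph V} {A B : Fin 3 → Set V}
    (h : IsK33Minor G A B) (i j : Fin 3) {a b : V} (ha : a ∈ A i) (hb : b ∈ B j) :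
    (G.induce (A i ∪ B j)).Reachable ⟨a, Or.inl ha⟩ ⟨b, Or.inr hb⟩ := by
  obtain ⟨a', ha', b', hb', hab⟩ := h.exists_adj i j
  have h₁ := (h.preconnected_left i ⟨a, ha⟩ ⟨a', ha'⟩).map
    (G.induceHomOfLE (Set.subset_union_left (s := A i) (t := B j))).toHom
  have h₂ := (h.preconnected_right j ⟨b', hb'⟩ ⟨b, hb⟩).map
    (G.induceHomOfLE (Set.subset_union_right (s := A i) (t := B j))).toHom
  have h₃ : (G.induce (A i ∪ B j)).Adj ⟨a', Or.inl ha'⟩ ⟨b', Or.inr hb'⟩ := hab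
  exact h₁.trans (h₃.reachable.trans h₂)

/-- A planar graph has no `K₃,₃` minor. -/
theorem IsPlanar.not_isK33Minor {V : Type} {G : SimpleGraph V} (hG : IsPlanar G)
    (A B : Fin 3 → Set V) : ¬ IsK33Minor G A B := by
  intro h
  obtain ⟨pt, arc, hpt, -, hend, hav, hint⟩ := hG
  choose a ha using h.nonempty_left
  choose b hb using h.nonempty_right
  -- These curves need not be simple, and two that share an index may meet. Only independent ones
  -- must be disjoint, and those run through disjoint vertex sets.
  have hj : ∀ i j, JoinedIn (drawnPart pt arc (A i ∪ B j)) (pt (a i)) (pt (b j)) := fun i j =>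
    joinedIn_drawnPart hend _ _ (h.preconnected_union i j (ha i) (hb j))
  let Φ := Complex.equivRealProdCLM.symm
  let R : Fin 6 → ℂ := fun v => Φ (if v.1 % 2 = 0 then pt (a ⟨v / 2, by omega⟩)
    else pt (b ⟨v / 2, by omega⟩))
  refine not_exists_K33_drawing R (fun i j t => Φ ((hj i j).somePath.extend t))
    (fun i j => Φ.continuous.comp (hj i j).somePath.continuous_extend) ?_ ?_ ?_
  · intro i j
    simp [R, leftVertex]
  · intro i j
    have : (2 * (j : ℕ) + 1) / 2 = j := by omega
    simp [R, rightVertex, this]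
  · intro i j i' j' hi hjj s t hst
    have hmem : ∀ i j t, (hj i j).somePath.extend t ∈ drawnPart pt arc (A i ∪ B j) :=
      fun i j t => (hj i j).somePath_mem _
    refine Set.disjoint_left.1 (disjoint_drawnPart hpt hav hint
      (S := A i ∪ B j) (T := A i' ∪ B j') ?_) (hmem i j s) (Φ.injective hst ▸ hmem i' j' t)
    rw [Set.disjoint_union_left, Set.disjoint_union_right, Set.disjoint_union_right]
    exact ⟨⟨h.disjoint_left i i' hi, h.disjoint i j'⟩, (h.disjoint i' j).symm,
      h.disjoint_right j j' hjj⟩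

/-! ### Iterated band decompositions of graphs without a `K₃,₃` minor -/

/-- `u` and `v` are joined by a walk of `G` inside `S`. -/
def ReachableIn {V : Type*} (G : SimpleGraph V) (S : Set V) (u v : V) : Prop :=
  ∃ (hu : u ∈ S) (hv : v ∈ S), (G.induce S).Reachable ⟨u, hu⟩ ⟨v, hv⟩

namespace ReachableIn

variable {V : Type*} {G F : SimpleGraph V} {S T : Set V} {u v w : V}

theorem refl (hu : u ∈ S) : ReachableIn G S u u := ⟨hu, hu, .refl _⟩

theorem symm (h : ReachableIn G S u v) : ReachableIn G S v u :=
  ⟨h.2.1, h.1, h.2.2.symm⟩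

theorem trans (h : ReachableIn G S u v) (h' : ReachableIn G S v w) : ReachableIn G S u w :=
  ⟨h.1, h'.2.1, h.2.2.trans h'.2.2⟩

theorem of_adj (hu : u ∈ S) (hv : v ∈ S) (h : G.Adj u v) : ReachableIn G S u v :=
  ⟨hu, hv, SimpleGraph.Adj.reachable (G := G.induce S) h⟩

theorem mono_graph (hFG : F ≤ G) (h : ReachableIn F S u v) : ReachableIn G S u v :=
  ⟨h.1, h.2.1, h.2.2.mono fun _ _ hab => hFG hab⟩

theorem preconnected (c : V) (h : ∀ v ∈ S, ReachableIn G S c v) :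
    (G.induce S).Preconnected := fun u v =>
  ((h u u.2).symm.trans (h v v.2)).2.2

theorem of_path {P : ℕ → V} {m n : ℕ} (hmn : m ≤ n) (hS : ∀ k, m ≤ k → k ≤ n → P k ∈ S)
    (hadj : ∀ k, m ≤ k → k < n → G.Adj (P k) (P (k + 1))) : ReachableIn G S (P m) (P n) := by
  induction n, hmn using Nat.le_induction with
  | base => exact refl (hS m le_rfl le_rfl)
  | succ n hmn ih =>
    exact (ih (fun k h h' => hS k h (by omega)) fun k h h' => hadj k h (by omega)).trans
      (of_adj (hS n hmn (by omega)) (hS _ (by omega) le_rfl) (hadj n hmn (by omega)))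

end ReachableIn

theorem SimpleGraph.Reachable.reachableIn {V : Type*} {F : SimpleGraph V} {x v : V}
    (h : F.Reachable x v) : ReachableIn F {v | F.Reachable x v} x v := by
  rw [SimpleGraph.reachable_iff_reflTransGen] at h
  induction h with
  | refl => exact .refl (SimpleGraph.Reachable.refl (G := F) x)
  | @tail b c _ hbc ih =>
    have hb : F.Reachable x b := ih.2.1
    exact ih.trans (.of_adj hb (hb.trans hbc.reachable) hbc)

theorem SimpleGraph.edist_path_le {V : Type*} {G : SimpleGraph V} {P : ℕ → V} {m n : ℕ}
    (hmn : m ≤ n) (hadj : ∀ k, m ≤ k → k < n → G.Adj (P k) (P (k + 1))) :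
    G.edist (P m) (P n) ≤ (n - m : ℕ) := by
  induction n, hmn using Nat.le_induction with
  | base => simp
  | succ n hmn ih =>
    have h₁ := ih fun k h h' => hadj k h (by omega)
    have h₂ : G.edist (P n) (P (n + 1)) = 1 :=
      SimpleGraph.edist_eq_one_iff_adj.2 (hadj n hmn (by omega))
    refine SimpleGraph.edist_triangle.trans ((add_le_add h₁ h₂.le).trans ?_)
    rw [Nat.succ_sub hmn]
    push_cast
    exact le_rfl

/-- `f` behaves like the distance from a root chosen in every component of `F`. -/
structure IsLayering {V : Type*} (F : SimpleGraph V) (f : V → ℕ) : Prop where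
  le_succ : ∀ x y, F.Adj x y → f x ≤ f y + 1
  exists_pred : ∀ x, 0 < f x → ∃ y, F.Adj y x ∧ f x = f y + 1
  eq_of_zero : ∀ x y, F.Reachable x y → f x = 0 → f y = 0 → x = y

theorem SimpleGraph.Reachable.exists_adj_dist_eq_succ {V : Type*} {F : SimpleGraph V} {c x : V}
    (h : F.Reachable c x) (hx : 0 < F.dist c x) :
    ∃ y, F.Adj y x ∧ F.dist c x = F.dist c y + 1 := by
  obtain ⟨p, hp⟩ := h.symm.exists_walk_length_eq_dist
  rw [SimpleGraph.dist_comm] at hp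
  cases p with
  | nil => simp at hx
  | @cons _ y _ hxy q =>
    have hq : F.dist c y ≤ q.length := by
      rw [SimpleGraph.dist_comm]
      exact SimpleGraph.dist_le q
    have h₁ : F.dist c x ≤ F.dist c y + F.dist y x := hxy.symm.reachable.dist_triangle_right _
    rw [SimpleGraph.dist_eq_one_iff_adj.2 hxy.symm] at h₁
    simp only [SimpleGraph.Walk.length_cons] at hp
    exact ⟨y, hxy.symm, by omega⟩

theorem exists_isLayering {V : Type*} (F : SimpleGraph V) : ∃ f, IsLayering F f := by
  let root : V → V := fun x => (F.connectedComponentMk x).out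
  have hroot : ∀ x, F.Reachable (root x) x := fun x =>
    SimpleGraph.ConnectedComponent.exact (Quot.out_eq _)
  have hrr : ∀ x y, F.Reachable x y → root x = root y := fun x y h => by
    simp only [root, SimpleGraph.ConnectedComponent.sound h]
  refine ⟨fun x => F.dist (root x) x, fun x y hxy => ?_, fun x hx => ?_, fun x y hxy hx hy => ?_⟩
  · have h₁ : F.dist (root x) x ≤ F.dist (root x) y + F.dist y x :=
      hxy.symm.reachable.dist_triangle_right _
    rw [SimpleGraph.dist_eq_one_iff_adj.2 hxy.symm] at h₁
    change F.dist (root x) x ≤ F.dist (root y) y + 1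
    rwa [← hrr x y hxy.reachable]
  · obtain ⟨y, hyx, hy⟩ := (hroot x).exists_adj_dist_eq_succ hx
    refine ⟨y, hyx, ?_⟩
    rwa [hrr y x hyx.reachable]
  · rw [(hroot x).dist_eq_zero_iff] at hx
    rw [(hroot y).dist_eq_zero_iff] at hy
    rw [← hx, ← hy, hrr x y hxy]

namespace IsLayering

variable {V : Type*} {F : SimpleGraph V} {f : V → ℕ}

/-- A shortest way down to the root, indexed by level rather than by time; the values of `P` above
level `f w` are irrelevant. -/
theorem exists_descent (hf : IsLayering F f) (w : V) :
    ∃ P : ℕ → V, P (f w) = w ∧ (∀ n ≤ f w, f (P n) = n) ∧ ∀ n < f w, F.Adj (P n) (P (n + 1)) := by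
  suffices h : ∀ n w, f w = n →
      ∃ P : ℕ → V, P n = w ∧ (∀ k ≤ n, f (P k) = k) ∧ ∀ k < n, F.Adj (P k) (P (k + 1)) from
    h _ w rfl
  intro n
  induction n with
  | zero =>
    intro w hw
    exact ⟨fun _ => w, rfl, fun k hk => by simp [hw]; omega, fun k hk => by omega⟩
  | succ n ih =>
    intro w hw
    obtain ⟨y, hyw, hy⟩ := hf.exists_pred w (by omega)
    obtain ⟨P, hP, hPf, hPa⟩ := ih y (by omega)
    refine ⟨fun k => if k = n + 1 then w else P k, by simp, fun k hk => ?_, fun k hk => ?_⟩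
    · by_cases h : k = n + 1
      · simp [h, hw]
      · simp only [h, if_false]
        exact hPf k (by omega)
    · by_cases h : k = n
      · simp [h, hP, hyw]
      · have h₁ : k ≠ n + 1 := by omega
        simp only [h₁, if_false, Nat.add_right_cancel_iff, h]
        exact hPa k (by omega)

theorem reachable_descent {P : ℕ → V} {N m n : ℕ} (hP : ∀ n < N, F.Adj (P n) (P (n + 1)))
    (hm : m ≤ N) (hn : n ≤ N) : F.Reachable (P m) (P n) := by
  have h : ∀ k ≤ N, F.Reachable (P 0) (P k) := by
    intro k
    induction k with
    | zero => exact fun _ => .refl _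
    | succ k ih => exact fun hk => (ih (by omega)).trans (hP k (by omega)).reachable
  exact (h m hm).symm.trans (h n hn)

theorem exists_root (hf : IsLayering F f) (x : V) : ∃ c, F.Reachable x c ∧ f c = 0 := by
  obtain ⟨P, hP, hPf, hPa⟩ := hf.exists_descent x
  refine ⟨P 0, ?_, hPf 0 (by omega)⟩
  conv => enter [2]; rw [← hP]
  exact reachable_descent hPa le_rfl (by omega)

theorem reachableIn_root (hf : IsLayering F f) {x c : V} (hc : F.Reachable x c) (hc0 : f c = 0)
    {θ : ℕ} {v : V} (hv : F.Reachable x v) (hvθ : f v < θ) :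
    ReachableIn F {v | F.Reachable x v ∧ f v < θ} c v := by
  obtain ⟨P, hP, hPf, hPa⟩ := hf.exists_descent v
  have hr : ∀ k ≤ f v, F.Reachable x (P k) := fun k hk => hv.trans (by
    conv => enter [2]; rw [← hP]
    exact reachable_descent hPa le_rfl hk)
  have h0 : P 0 = c := hf.eq_of_zero _ _ ((hr 0 (by omega)).symm.trans hc) (hPf 0 (by omega)) hc0
  have h := ReachableIn.of_path (G := F) (S := {v | F.Reachable x v ∧ f v < θ}) (P := P)
    (Nat.zero_le (f v)) (fun k _ hk => ⟨hr k hk, by rw [hPf k hk]; omega⟩) fun k _ hk => hPa k hk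
  rwa [h0, hP] at h

/-- Descents to the root never leave a sublevel set. This makes the inner parts of the two layerings
usable as branch sets. -/
theorem preconnected_lt (hf : IsLayering F f) (x : V) (θ : ℕ) :
    (F.induce {v | F.Reachable x v ∧ f v < θ}).Preconnected := by
  obtain ⟨c, hc, hc0⟩ := hf.exists_root x
  exact ReachableIn.preconnected c fun v hv => hf.reachableIn_root hc hc0 hv.1 hv.2

theorem edist_le (hf : IsLayering F f) {x y : V} (hxy : F.Reachable x y) :
    F.edist x y ≤ (f x + f y : ℕ) := by
  obtain ⟨P, hP, hPf, hPa⟩ := hf.exists_descent x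
  obtain ⟨Q, hQ, hQf, hQa⟩ := hf.exists_descent y
  have hPQ : P 0 = Q 0 := by
    refine hf.eq_of_zero _ _ ?_ (hPf 0 (by omega)) (hQf 0 (by omega))
    have h₁ := reachable_descent hPa (Nat.zero_le _) le_rfl
    have h₂ := reachable_descent hQa le_rfl (Nat.zero_le _)
    rw [hP] at h₁
    rw [hQ] at h₂
    exact h₁.trans (hxy.trans h₂)
  have h₁ := SimpleGraph.edist_path_le (Nat.zero_le (f x)) fun k _ hk => hPa k hk
  have h₂ := SimpleGraph.edist_path_le (Nat.zero_le (f y)) fun k _ hk => hQa k hk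
  rw [hP, SimpleGraph.edist_comm, Nat.sub_zero] at h₁
  rw [hQ, ← hPQ, Nat.sub_zero] at h₂
  push_cast
  exact SimpleGraph.edist_triangle.trans (add_le_add h₁ h₂)

end IsLayering

/-- The edges of `F` inside the bands of width `R`, shifted by `o`, of the function `f`. -/
def bandGraph {V : Type*} (F : SimpleGraph V) (f : V → ℕ) (R o : ℕ) : SimpleGraph V where
  Adj x y := F.Adj x y ∧ (f x + o) / R = (f y + o) / R
  symm := ⟨fun _ _ h => ⟨h.1.symm, h.2.symm⟩⟩
  loopless := ⟨fun _ h => F.loopless.irrefl _ h.1⟩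

theorem bandGraph_le {V : Type*} (F : SimpleGraph V) (f : V → ℕ) (R o : ℕ) :
    bandGraph F f R o ≤ F := fun _ _ h => h.1

theorem div_eq_of_reachable_bandGraph {V : Type*} {F : SimpleGraph V} {f : V → ℕ} {R o : ℕ}
    {x v : V} (h : (bandGraph F f R o).Reachable x v) : (f x + o) / R = (f v + o) / R := by
  rw [SimpleGraph.reachable_iff_reflTransGen] at h
  induction h with
  | refl => rfl
  | tail _ hbc ih => exact ih.trans hbc.2

theorem lt_add_of_reachable_bandGraph {V : Type*} {F : SimpleGraph V} {f : V → ℕ} {R o : ℕ}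
    (hR : 0 < R) {x v : V} (h : (bandGraph F f R o).Reachable x v) : f v < f x + R := by
  have h₁ := div_eq_of_reachable_bandGraph h
  have h₂ := Nat.div_add_mod (f x + o) R
  have h₃ := Nat.div_add_mod (f v + o) R
  have h₄ := Nat.mod_lt (f v + o) hR
  rw [h₁] at h₂
  omega

/-- The band is the interval of levels whose shifted quotient agrees with that of `x`. The bound `R
≤ f x` keeps its lower end `R * β - o` from being truncated at zero. -/
theorem exists_band {V : Type*} (F : SimpleGraph V) (f : V → ℕ) {R : ℕ} (o : ℕ) (hR : 0 < R)
    {x : V} (hx : R ≤ f x) : ∃ a, f x < a + R ∧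
      (∀ v, (bandGraph F f R o).Reachable x v → a ≤ f v ∧ f v < a + R) ∧
      ∀ v w, F.Adj v w → a ≤ f v → f v < a + R → a ≤ f w → f w < a + R →
        (bandGraph F f R o).Adj v w := by
  have h₂ := Nat.div_add_mod (f x + o) R
  have h₃ := Nat.mod_lt (f x + o) hR
  set β := (f x + o) / R
  have hβ : ∀ v, (R * β - o ≤ f v ∧ f v < R * β - o + R) ↔ (f v + o) / R = β := by
    intro v
    rw [Nat.div_eq_iff hR, mul_comm β R]
    omega
  refine ⟨R * β - o, by omega, fun v hv => (hβ v).2 (div_eq_of_reachable_bandGraph hv).symm,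
    fun v w hvw h₁ h₂ h₃ h₄ => ⟨hvw, ?_⟩⟩
  rw [(hβ v).1 ⟨h₁, h₂⟩, (hβ w).1 ⟨h₃, h₄⟩]

/-- A discrete intermediate value argument: along a walk of `H` the distance in `G` from `x` grows
by at most one per step. -/
theorem exists_reachable_dist_eq {V : Type*} {G H : SimpleGraph V} (hHG : H ≤ G) {x y : V}
    (h : H.Reachable x y) {n : ℕ} (hn : n ≤ G.dist x y) :
    ∃ z, H.Reachable x z ∧ G.dist x z = n := by
  rw [SimpleGraph.reachable_iff_reflTransGen] at h
  induction h with
  | refl => exact ⟨x, .refl _, by simp at hn ⊢; omega⟩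
  | @tail b c hb hbc ih =>
    by_cases hnb : n ≤ G.dist x b
    · exact ih hnb
    · have hxb : H.Reachable x b := (SimpleGraph.reachable_iff_reflTransGen _ _).2 hb
      have h₁ := (hHG hbc).reachable.dist_triangle_right x
      rw [SimpleGraph.dist_eq_one_iff_adj.2 (hHG hbc)] at h₁
      exact ⟨c, hxb.trans hbc.reachable, by omega⟩

/-- The arm leading from `w`, in the innermost cluster, to the outer parts of the two layerings. -/
theorem exists_arm {V : Type*} {G : SimpleGraph V} {f₀ f₁ : V → ℕ} {R o₀ o₁ a₀ θ : ℕ}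
    (hR : 0 < R) (hf₀ : IsLayering G f₀) (hf₁ : IsLayering (bandGraph G f₀ R o₀) f₁) {x w : V}
    (ha₀ : 0 < a₀) (hθ : 0 < θ)
    (h₀ : ∀ v, (bandGraph G f₀ R o₀).Reachable x v → a₀ ≤ f₀ v ∧ f₀ v < a₀ + R)
    (h₀' : ∀ v w, G.Adj v w → a₀ ≤ f₀ v → f₀ v < a₀ + R → a₀ ≤ f₀ w → f₀ w < a₀ + R →
        (bandGraph G f₀ R o₀).Adj v w)
    (h₁ : ∀ v, (bandGraph (bandGraph G f₀ R o₀) f₁ R o₁).Reachable x v →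
      θ + 2 * R ≤ f₁ v ∧ f₁ v < θ + 2 * R + R)
    (h₁' : ∀ v w, (bandGraph G f₀ R o₀).Adj v w → θ + 2 * R ≤ f₁ v → f₁ v < θ + 2 * R + R →
      θ + 2 * R ≤ f₁ w → f₁ w < θ + 2 * R + R →
        (bandGraph (bandGraph G f₀ R o₀) f₁ R o₁).Adj v w)
    (hw : (bandGraph (bandGraph G f₀ R o₀) f₁ R o₁).Reachable x w) :
    ∃ N : Set V, N.Nonempty ∧ (G.induce N).Preconnected ∧
      (∀ v ∈ N, (bandGraph G f₀ R o₀).Reachable x v ∧ θ ≤ f₁ v ∧ f₁ v < θ + 2 * R ∧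
        G.edist w v ≤ (3 * R : ℕ)) ∧
      (∃ v ∈ N, ∃ a, (G.Reachable x a ∧ f₀ a < a₀) ∧ G.Adj v a) ∧
      (∃ v ∈ N, ∃ a, ((bandGraph G f₀ R o₀).Reachable x a ∧ f₁ a < θ) ∧ G.Adj v a) ∧
      ∃ v ∈ N, ∃ a, (bandGraph (bandGraph G f₀ R o₀) f₁ R o₁).Reachable x a ∧ G.Adj v a := by
  set F₁ := bandGraph G f₀ R o₀
  set F₂ := bandGraph F₁ f₁ R o₁
  have hF₁ : F₁ ≤ G := bandGraph_le _ _ _ _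
  have hF₂ : F₂ ≤ F₁ := bandGraph_le _ _ _ _
  obtain ⟨hwl, hwu⟩ := h₁ w hw
  obtain ⟨P, hPw, hPf, hPa⟩ := hf₁.exists_descent w
  have hxP : ∀ n ≤ f₁ w, F₁.Reachable x (P n) := fun n hn => by
    refine (hw.mono hF₂).trans ?_
    have := IsLayering.reachable_descent hPa le_rfl hn
    rwa [hPw] at this
  -- The arm forks at `z`, the middle of the window from `θ` to `θ + 2 * R`: `P` goes on down `f₁`,
  -- while `Q` descends `f₀`. Since `z` lies in a band of width `R`, `Q` reaches level `a₀` in fewer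
  -- than `R` steps. Each of them changes `f₁` by at most one, so `Q` stays in the window.
  set z := P (θ + R) with hz
  have hxz : F₁.Reachable x z := hxP _ (by omega)
  have hfz : f₁ z = θ + R := hPf _ (by omega)
  obtain ⟨hzl, hzu⟩ := h₀ z hxz
  obtain ⟨Q, hQz, hQf, hQa⟩ := hf₀.exists_descent z
  have hQ : ∀ k, k ≤ f₀ z - a₀ → F₁.Reachable x (Q (f₀ z - k)) ∧
      f₁ (Q (f₀ z - k)) ≤ θ + R + k ∧ θ + R ≤ f₁ (Q (f₀ z - k)) + k := by
    intro k
    induction k with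
    | zero => intro _; simp [hQz, hxz, hfz]
    | succ k ih =>
      intro hk
      obtain ⟨i₁, i₂, i₃⟩ := ih (by omega)
      have hadj := hQa (f₀ z - (k + 1)) (by omega)
      have e : f₀ z - (k + 1) + 1 = f₀ z - k := by omega
      rw [e] at hadj
      have l₁ := hQf (f₀ z - (k + 1)) (by omega)
      have l₂ := hQf (f₀ z - k) (by omega)
      have hadj₁ : F₁.Adj (Q (f₀ z - (k + 1))) (Q (f₀ z - k)) :=
        h₀' _ _ hadj (by omega) (by omega) (by omega) (by omega)
      have m₁ := hf₁.le_succ _ _ hadj₁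
      have m₂ := hf₁.le_succ _ _ hadj₁.symm
      exact ⟨i₁.trans hadj₁.symm.reachable, by omega, by omega⟩
  have hQ' : ∀ n, a₀ ≤ n → n ≤ f₀ z → F₁.Reachable x (Q n) ∧ θ ≤ f₁ (Q n) ∧
      f₁ (Q n) < θ + 2 * R := by
    intro n hn hn'
    obtain ⟨i₁, i₂, i₃⟩ := hQ (f₀ z - n) (by omega)
    rw [Nat.sub_sub_self hn'] at i₁ i₂ i₃
    exact ⟨i₁, by omega, by omega⟩
  have hPG : ∀ n < f₁ w, G.Adj (P n) (P (n + 1)) := fun n hn => hF₁ (hPa n hn)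
  have hwP : ∀ n, θ ≤ n → n ≤ f₁ w → G.edist w (P n) ≤ (f₁ w - n : ℕ) := by
    intro n _ hn
    have := SimpleGraph.edist_path_le (G := G) hn fun k _ hk => hPG k hk
    rwa [hPw, SimpleGraph.edist_comm] at this
  have hwQ : ∀ n, a₀ ≤ n → n ≤ f₀ z → G.edist w (Q n) ≤ (3 * R : ℕ) := by
    intro n hn hn'
    have d₁ := hwP (θ + R) (by omega) (by omega)
    have d₂ := SimpleGraph.edist_path_le (G := G) hn' fun k _ hk => hQa k hk
    rw [hQz, SimpleGraph.edist_comm] at d₂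
    refine SimpleGraph.edist_triangle.trans ((add_le_add d₁ d₂).trans ?_)
    exact_mod_cast (by omega : f₁ w - (θ + R) + (f₀ z - n) ≤ 3 * R)
  let N : Set V := {v | (∃ n, θ ≤ n ∧ n < θ + 2 * R ∧ v = P n) ∨
    ∃ n, a₀ ≤ n ∧ n ≤ f₀ z ∧ v = Q n}
  have hPN : ∀ n, θ ≤ n → n < θ + 2 * R → P n ∈ N := fun n h h' => Or.inl ⟨n, h, h', rfl⟩
  have hQN : ∀ n, a₀ ≤ n → n ≤ f₀ z → Q n ∈ N := fun n h h' => Or.inr ⟨n, h, h', rfl⟩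
  refine ⟨N, ⟨z, hPN _ (by omega) (by omega)⟩, ?_, ?_, ?_, ?_, ?_⟩
  · refine ReachableIn.preconnected z ?_
    rintro v (⟨n, hn, hn', rfl⟩ | ⟨n, hn, hn', rfl⟩)
    · rcases le_total n (θ + R) with h | h
      · exact (ReachableIn.of_path h (fun k _ _ => hPN k (by omega) (by omega))
          fun k _ _ => hPG k (by omega)).symm
      · exact ReachableIn.of_path h (fun k _ _ => hPN k (by omega) (by omega))
          fun k _ _ => hPG k (by omega)
    · have := ReachableIn.of_path (G := G) (S := N) hn' (fun k _ _ => hQN k (by omega) (by omega))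
          fun k _ _ => hQa k (by omega)
      rw [hQz] at this
      exact this.symm
  · rintro v (⟨n, hn, hn', rfl⟩ | ⟨n, hn, hn', rfl⟩)
    · refine ⟨hxP n (by omega), ?_, ?_, (hwP n hn (by omega)).trans ?_⟩
      · rw [hPf n (by omega)]; exact hn
      · rw [hPf n (by omega)]; exact hn'
      · exact_mod_cast (by omega : f₁ w - n ≤ 3 * R)
    · obtain ⟨i₁, i₂, i₃⟩ := hQ' n hn hn'
      exact ⟨i₁, i₂, i₃, hwQ n hn hn'⟩
  · have hadj := hQa (a₀ - 1) (by omega)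
    rw [Nat.sub_add_cancel ha₀] at hadj
    refine ⟨Q a₀, hQN _ le_rfl hzl, Q (a₀ - 1), ⟨?_, ?_⟩, hadj.symm⟩
    · exact ((hQ' a₀ le_rfl hzl).1.mono hF₁).trans hadj.symm.reachable
    · rw [hQf _ (by omega)]; omega
  · have hadj := hPG (θ - 1) (by omega)
    rw [Nat.sub_add_cancel hθ] at hadj
    refine ⟨P θ, hPN _ le_rfl (by omega), P (θ - 1), ⟨hxP _ (by omega), ?_⟩, hadj.symm⟩
    rw [hPf _ (by omega)]; omega
  · have hadj := hPG (θ + 2 * R - 1) (by omega)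
    rw [Nat.sub_add_cancel (by omega)] at hadj
    refine ⟨P (θ + 2 * R - 1), hPN _ (by omega) (by omega), P (θ + 2 * R), ?_, hadj⟩
    -- From level `θ + 2 * R` up to `w` the descent runs inside a single band of `f₁`, hence inside
    -- the innermost cluster.
    have hr : ∀ k, θ + 2 * R ≤ k → k ≤ f₁ w → F₂.Reachable (P (θ + 2 * R)) (P k) := by
      intro k hk
      induction k, hk using Nat.le_induction with
      | base => exact fun _ => .refl _
      | succ k hk ih =>
        intro hk'
        have l₁ := hPf k (by omega)
        have l₂ := hPf (k + 1) hk'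
        exact (ih (by omega)).trans (h₁' _ _ (hPa k (by omega)) (by omega) (by omega)
          (by omega) (by omega)).reachable
    have := hr (f₁ w) hwl le_rfl
    rw [hPw] at this
    exact hw.trans this.symm

/-- In a graph without a `K₃,₃` minor, two successive band decompositions leave components of
bounded diameter (in the metric of the whole graph). -/
theorem edist_le_of_reachable_bandGraph {V : Type*} {G : SimpleGraph V} {f₀ f₁ : V → ℕ}
    {R o₀ o₁ : ℕ} (hR : 0 < R) (hf₀ : IsLayering G f₀)
    (hf₁ : IsLayering (bandGraph G f₀ R o₀) f₁) (hG : ∀ A B, ¬ IsK33Minor G A B) {x y : V}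
    (hxy : (bandGraph (bandGraph G f₀ R o₀) f₁ R o₁).Reachable x y) :
    G.edist x y ≤ (12 * R + 1 : ℕ) := by
  by_contra hlt
  set F₁ := bandGraph G f₀ R o₀
  set F₂ := bandGraph F₁ f₁ R o₁
  have hF₁ : F₁ ≤ G := bandGraph_le _ _ _ _
  have hF₂ : F₂ ≤ F₁ := bandGraph_le _ _ _ _
  have hxy₁ : F₁.Reachable x y := hxy.mono hF₂
  have hxy₀ : G.Reachable x y := hxy₁.mono hF₁
  have hdist : 12 * R + 1 < G.dist x y := by
    rw [← hxy₀.coe_dist_eq_edist, not_le] at hlt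
    exact_mod_cast hlt
  -- Close to a root of either layering, the route through that root is already too short. So `x`
  -- lies far out in both, which leaves room for the two inner branch sets and the window of width
  -- `2 * R`.
  have hx₀ : R ≤ f₀ x := by
    by_contra h
    have h₁ := lt_add_of_reachable_bandGraph hR hxy₁
    have h₂ := hf₀.edist_le hxy₀
    exact hlt (h₂.trans (by exact_mod_cast (by omega : f₀ x + f₀ y ≤ 12 * R + 1)))
  have hx₁ : 4 * R ≤ f₁ x := by
    by_contra h
    have h₁ := lt_add_of_reachable_bandGraph hR hxy
    have h₂ := (SimpleGraph.edist_anti hF₁).trans (hf₁.edist_le hxy₁)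
    exact hlt (h₂.trans (by exact_mod_cast (by omega : f₁ x + f₁ y ≤ 12 * R + 1)))
  obtain ⟨a₀, hxa₀, h₀, h₀'⟩ := exists_band G f₀ o₀ hR hx₀
  obtain ⟨a₁, hxa₁, h₁, h₁'⟩ := exists_band F₁ f₁ o₁ hR (x := x) (by omega)
  obtain ⟨θ, rfl⟩ : ∃ θ, a₁ = θ + 2 * R := ⟨a₁ - 2 * R, by omega⟩
  have ha₀ : 0 < a₀ := by omega
  -- A vertex of the cluster at distance exactly `6 * R + 1` from `x` is also more than `6 * R` from
  -- `y`. Arms reach at most `3 * R`, so the arms of `x`, `z`, `y` are disjoint.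
  obtain ⟨z, hxz, hz⟩ := exists_reachable_dist_eq (hF₂.trans hF₁) hxy
    (n := 6 * R + 1) (by omega)
  have hxz₀ : G.Reachable x z := (hxz.mono hF₂).mono hF₁
  have hzy : 6 * R < G.dist z y := by
    have := hxz₀.dist_triangle_left y
    omega
  let W : Fin 3 → V := ![x, z, y]
  have hW : ∀ i, F₂.Reachable x (W i) := by
    intro i
    fin_cases i
    exacts [.refl _, hxz, hxy]
  have hWd : ∀ i j, i ≠ j → 6 * R < G.dist (W i) (W j) := by
    intro i j hij
    have e₁ := G.dist_comm (u := x) (v := z)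
    have e₂ := G.dist_comm (u := x) (v := y)
    have e₃ := G.dist_comm (u := z) (v := y)
    fin_cases i <;> fin_cases j <;> simp [W] at hij ⊢ <;> omega
  choose N hNne hNc hNv hN₀ hN₁ hN₂ using fun i => exists_arm hR hf₀ hf₁ ha₀
    (by omega : 0 < θ) h₀ h₀' h₁ h₁' (hW i)
  -- The three arms form one side of the minor. The other side consists of the part inside the first
  -- band, the part below the window of the second layering, and the cluster itself.
  let B : Fin 3 → Set V := ![{v | G.Reachable x v ∧ f₀ v < a₀},
    {v | F₁.Reachable x v ∧ f₁ v < θ}, {v | F₂.Reachable x v}]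
  have hNB : ∀ i j, ∃ a ∈ N i, ∃ b ∈ B j, G.Adj a b := by
    intro i j
    fin_cases j
    exacts [hN₀ i, hN₁ i, hN₂ i]
  refine hG N B ⟨hNne, fun j => ?_, hNc, fun j => ?_, fun i i' hi => ?_, fun j j' hj => ?_,
    fun i j => ?_, hNB⟩
  · obtain ⟨_, _, b, hb, _⟩ := hNB 0 j
    exact ⟨b, hb⟩
  · fin_cases j
    · exact hf₀.preconnected_lt x a₀
    · exact (hf₁.preconnected_lt x θ).mono fun _ _ h => hF₁ h
    · exact ReachableIn.preconnected x fun v hv =>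
        (SimpleGraph.Reachable.reachableIn hv).mono_graph (hF₂.trans hF₁)
  · refine Set.disjoint_left.2 fun v hv hv' => ?_
    have d₁ := (hNv i v hv).2.2.2
    have d₂ := (hNv i' v hv').2.2.2
    rw [SimpleGraph.edist_comm] at d₂
    have d := (SimpleGraph.edist_triangle (G := G)).trans (add_le_add d₁ d₂)
    have hr : G.Reachable (W i) (W i') :=
      (((hW i).symm.trans (hW i')).mono hF₂).mono hF₁
    rw [← hr.coe_dist_eq_edist] at d
    have d' : G.dist (W i) (W i') ≤ 3 * R + 3 * R := by exact_mod_cast d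
    have := hWd i i' hi
    omega
  · have d₀₁ : Disjoint (B 0) (B 1) := Set.disjoint_left.2 fun v hv hv' => by
      have := (h₀ v hv'.1).1
      have := hv.2
      omega
    have d₀₂ : Disjoint (B 0) (B 2) := Set.disjoint_left.2 fun v hv hv' => by
      have := (h₀ v (SimpleGraph.Reachable.mono hF₂ hv')).1
      have := hv.2
      omega
    have d₁₂ : Disjoint (B 1) (B 2) := Set.disjoint_left.2 fun v hv hv' => by
      have := (h₁ v hv').1
      have := hv.2
      omega
    fin_cases j <;> fin_cases j' <;> first | exact absurd rfl hj | skip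
    exacts [d₀₁, d₀₂, d₀₁.symm, d₁₂, d₀₂.symm, d₁₂.symm]
  · refine Set.disjoint_left.2 fun v hv hv' => ?_
    obtain ⟨n₁, n₂, n₃, -⟩ := hNv i v hv
    fin_cases j
    · have := (h₀ v n₁).1
      have := hv'.2
      omega
    · have := hv'.2
      omega
    · have := (h₁ v hv').1
      omega

/-! ### Weighted hyperfiniteness -/

open scoped Classical in
/-- The weight of the edges of `G` that are missing in `H`, each edge having the sum of the weights
of its endpoints. -/
noncomputable def cutWeight {V : Type*} [Fintype V] (G H : SimpleGraph V) (p : V → ℝ) : ℝ :=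
  ∑ x, ∑ y, if G.Adj x y ∧ ¬ H.Adj x y then p x else 0

theorem cutWeight_triangle {V : Type*} [Fintype V] (G F H : SimpleGraph V) {p : V → ℝ}
    (hp : ∀ v, 0 < p v) : cutWeight G H p ≤ cutWeight G F p + cutWeight F H p := by
  classical
  simp only [cutWeight, ← Finset.sum_add_distrib]
  refine Finset.sum_le_sum fun x _ => Finset.sum_le_sum fun y _ => ?_
  have := hp x
  split_ifs <;> first | linarith | tauto

theorem sum_adj_le {V : Type*} [Fintype V] {G : SimpleGraph V} {d : ℕ}
    (hd : ∀ v, (G.neighborSet v).ncard ≤ d) {F : V → V → Prop} (hF : ∀ x y, F x y → G.Adj x y)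
    [∀ x y, Decidable (F x y)] (x : V) {c : ℝ} (hc : 0 ≤ c) :
    ∑ y, (if F x y then c else 0) ≤ d * c := by
  classical
  rw [← Finset.sum_filter, Finset.sum_const, nsmul_eq_mul]
  refine mul_le_mul_of_nonneg_right ?_ hc
  have h : ((Finset.univ.filter fun y => F x y : Finset V) : Set V) ⊆ G.neighborSet x := by
    intro y hy
    exact hF x y (by simpa using hy)
  have := Set.ncard_le_ncard h (Set.toFinite _)
  rw [Set.ncard_coe_finset] at this
  exact_mod_cast this.trans (hd x)

/-- Graphs in `𝒢` can be cut, with respect to any vertex weights, into pieces of bounded diameter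
at the cost of a small proportion of the total weight. -/
def IsHyperfinite {d : ℕ} (𝒢 : Set (FiniteGraph d)) : Prop :=
  ∀ ε : ℝ, 0 < ε → ∃ D : ℕ, ∀ G ∈ 𝒢, ∀ p : G.V → ℝ, (∀ v, 0 < p v) →
    ∃ H ≤ G.graph, (∀ x y, H.Reachable x y → G.graph.edist x y ≤ D) ∧
      cutWeight G.graph H p ≤ ε * ∑ v, p v

/-- Consecutive levels `a` and `a + 1` are separated only by the shift `o` with `a + 1 + o`
divisible by `R`, unique modulo `R`. -/
theorem card_offsets_le_one {R a b : ℕ} (h₁ : a ≤ b + 1) (h₂ : b ≤ a + 1) :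
    ((Finset.range R).filter fun o => (a + o) / R ≠ (b + o) / R).card ≤ 1 := by
  wlog hab : a ≤ b generalizing a b
  · have := this h₂ h₁ (by omega)
    simpa only [ne_comm] using this
  rcases hab.eq_or_lt with rfl | hlt
  · simp
  obtain rfl : b = a + 1 := by omega
  refine Finset.card_le_one.2 fun o ho o' ho' => ?_
  simp only [Finset.mem_filter, Finset.mem_range] at ho ho'
  have key : ∀ o, (a + o) / R ≠ (a + 1 + o) / R → (a + o + 1) % R = 0 := by
    intro o h
    by_contra hne
    refine h ?_
    rw [add_right_comm, Nat.succ_div, if_neg fun hd => hne (Nat.mod_eq_zero_of_dvd hd)]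
    rfl
  have e : (a + 1 + o) ≡ (a + 1 + o') [MOD R] := by
    have k₁ := key o ho.2
    have k₂ := key o' ho'.2
    rw [add_right_comm] at k₁ k₂
    exact k₁.trans k₂.symm
  have := Nat.ModEq.add_left_cancel' _ e
  rwa [Nat.ModEq, Nat.mod_eq_of_lt ho.1, Nat.mod_eq_of_lt ho'.1] at this

/-- Averaging: each edge is cut by at most one of the `R` shifts, so the total over all shifts is at
most `d` times the total weight. -/
theorem exists_offset {V : Type*} [Fintype V] {G F : SimpleGraph V} {d R : ℕ}
    (hd : ∀ v, (G.neighborSet v).ncard ≤ d) (hFG : F ≤ G) {f : V → ℕ} (hf : IsLayering F f)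
    (hR : 0 < R) {p : V → ℝ} (hp : ∀ v, 0 < p v) :
    ∃ o, cutWeight F (bandGraph F f R o) p ≤ d / R * ∑ v, p v := by
  classical
  have hsum : ∑ o ∈ Finset.range R, cutWeight F (bandGraph F f R o) p ≤ d * ∑ v, p v := by
    simp only [cutWeight]
    rw [Finset.sum_comm, Finset.mul_sum]
    refine Finset.sum_le_sum fun x _ => ?_
    rw [Finset.sum_comm]
    refine le_trans (Finset.sum_le_sum fun y _ => ?_)
      (sum_adj_le hd (F := F.Adj) (fun _ _ h => hFG h) x (hp x).le)
    by_cases hxy : F.Adj x y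
    · simp only [hxy, true_and, bandGraph, if_true]
      rw [← Finset.sum_filter, Finset.sum_const, nsmul_eq_mul]
      have h : (((Finset.range R).filter fun o => (f x + o) / R ≠ (f y + o) / R).card : ℝ) ≤ 1 := by
        exact_mod_cast card_offsets_le_one (hf.le_succ x y hxy) (hf.le_succ y x hxy.symm)
      exact (mul_le_mul_of_nonneg_right h (hp x).le).trans (one_mul _).le
    · simp [hxy]
  have hR' : (0 : ℝ) < R := by exact_mod_cast hR
  obtain ⟨o, -, ho⟩ := Finset.exists_le_of_sum_le (s := Finset.range R)
    (f := fun o => cutWeight F (bandGraph F f R o) p) (g := fun _ => d / R * ∑ v, p v)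
    ⟨0, Finset.mem_range.2 hR⟩ (hsum.trans (by
      rw [Finset.sum_const, Finset.card_range, nsmul_eq_mul]
      field_simp
      exact le_rfl))
  exact ⟨o, ho⟩

theorem isHyperfinite_planarGraphs (d : ℕ) : IsHyperfinite (planarGraphs d) := by
  intro ε hε
  -- Each of the two rounds of cutting costs a proportion `d / R`.
  obtain ⟨R, hRd⟩ := exists_nat_gt (2 * d / ε)
  have hR' : (0 : ℝ) < R := lt_of_le_of_lt (by positivity) hRd
  have hR : 0 < R := by exact_mod_cast hR'
  refine ⟨12 * R + 1, fun G hG p hp => ?_⟩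
  obtain ⟨f₀, hf₀⟩ := exists_isLayering G.graph
  obtain ⟨o₀, ho₀⟩ := exists_offset G.degree_le le_rfl hf₀ hR hp
  obtain ⟨f₁, hf₁⟩ := exists_isLayering (bandGraph G.graph f₀ R o₀)
  obtain ⟨o₁, ho₁⟩ := exists_offset G.degree_le (bandGraph_le _ _ _ _) hf₁ hR hp
  refine ⟨_, (bandGraph_le _ f₁ R o₁).trans (bandGraph_le _ f₀ R o₀), fun x y hxy =>
    edist_le_of_reachable_bandGraph hR hf₀ hf₁ (IsPlanar.not_isK33Minor hG) hxy,
    (cutWeight_triangle _ _ _ hp).trans ((add_le_add ho₀ ho₁).trans ?_)⟩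
  rw [← add_mul]
  refine mul_le_mul_of_nonneg_right ?_ (Finset.sum_nonneg fun v _ => (hp v).le)
  rw [div_lt_iff₀ hε] at hRd
  rw [← add_div, div_le_iff₀ hR']
  linarith

/-! ### Property A implies hyperfiniteness -/

theorem abs_card_sub_card_le {α : Type*} [DecidableEq α] (A B : Finset α) :
    |(A.card : ℝ) - B.card| ≤ (symmDiff A B).card := by
  have h₁ : A.card ≤ B.card + (symmDiff A B).card := by
    rw [← Finset.card_sdiff_add_card_inter A B, add_comm]
    exact add_le_add (Finset.card_le_card Finset.inter_subset_right)
      (Finset.card_le_card (Finset.subset_union_left))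
  have h₂ : B.card ≤ A.card + (symmDiff A B).card := by
    rw [← Finset.card_sdiff_add_card_inter B A, add_comm]
    exact add_le_add (Finset.card_le_card Finset.inter_subset_right)
      (Finset.card_le_card (Finset.subset_union_right))
  rw [abs_sub_le_iff]
  constructor <;> rw [sub_le_iff_le_add'] <;> exact_mod_cast ‹_›

theorem sum_abs_card_fiber_le {α β : Type*} [DecidableEq α] [Fintype β] [DecidableEq β]
    (π : α → β) (A B : Finset α) :
    ∑ z, |((A.filter fun a => π a = z).card : ℝ) - (B.filter fun a => π a = z).card| ≤
      (symmDiff A B).card := by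
  rw [Finset.card_eq_sum_card_fiberwise (s := symmDiff A B) (f := π) (t := Finset.univ)
    (fun _ _ => Finset.mem_univ _)]
  push_cast
  refine Finset.sum_le_sum fun z _ => ?_
  refine (abs_card_sub_card_le _ _).trans ?_
  refine Nat.cast_le.2 (Finset.card_le_card fun a ha => ?_)
  simp only [Finset.mem_symmDiff, Finset.mem_filter] at ha ⊢
  tauto

/-- This turns an `ℓ¹` difference into a count of the thresholds that separate two vertices. -/
theorem card_separating_le (N m m' : ℕ) :
    (((Finset.range N).filter fun k => ¬ (k < m ↔ k < m')).card : ℝ) ≤ |(m : ℝ) - m'| := by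
  wlog h : m ≤ m' generalizing m m'
  · rw [abs_sub_comm]
    simpa only [iff_comm] using this m' m (by omega)
  have hs : ((Finset.range N).filter fun k => ¬ (k < m ↔ k < m')) ⊆ Finset.Ico m m' := by
    intro k hk
    simp only [Finset.mem_filter, Finset.mem_Ico] at hk ⊢
    omega
  have hc := Finset.card_le_card hs
  rw [Nat.card_Ico] at hc
  rw [abs_sub_comm, abs_of_nonneg (by simpa using h), ← Nat.cast_sub h]
  exact_mod_cast hc

/-- The sets of Property A, rescaled so that all of them have the same size. -/
theorem exists_rescaling {V : Type*} [Fintype V] [DecidableEq V] {G : SimpleGraph V}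
    {ε : ℝ} (hε : 0 < ε) {A : V → Finset (V × ℕ)} (hne : ∀ x, (A x).Nonempty)
    (hA : ∀ x y, G.Adj x y → ((symmDiff (A x) (A y)).card : ℝ) ≤ ε * (A x ∩ A y).card) :
    ∃ (N : ℕ) (m : V → V → ℕ), 0 < N ∧ (∀ x, ∑ z, m x z = N) ∧
      (∀ x z, 0 < m x z → ∃ e ∈ A x, e.1 = z) ∧
      ∀ x y, G.Adj x y → ∑ z, |(m x z : ℝ) - m y z| ≤ 2 * ε * N := by
  -- With `N` the product of all cardinalities, every element of `A x` gets the integer multiplicity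
  -- `N / |A x|`.
  obtain ⟨b, N, hN, hab⟩ : ∃ (b : V → ℕ) (N : ℕ), 0 < N ∧ ∀ x, (A x).card * b x = N :=
    ⟨fun x => ∏ y ∈ Finset.univ.erase x, (A y).card, ∏ y, (A y).card,
      Finset.prod_pos fun x _ => (hne x).card_pos,
      fun x => Finset.mul_prod_erase _ (fun y => (A y).card) (Finset.mem_univ x)⟩
  let a : V → ℕ := fun x => (A x).card
  let c : V → V → ℕ := fun x z => ((A x).filter fun e => e.1 = z).card
  have hc : ∀ x, ∑ z, c x z = a x := fun x =>
    (Finset.card_eq_sum_card_fiberwise (f := Prod.fst) (fun _ _ => Finset.mem_univ _)).symm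
  let m : V → V → ℕ := fun x z => c x z * b x
  have hm : ∀ x, ∑ z, m x z = N := fun x => by
    simp only [m]
    rw [← Finset.sum_mul, hc]
    exact hab x
  refine ⟨N, m, hN, hm, fun x z hk => ?_, fun x y hxy => ?_⟩
  · have hpos : 0 < c x z := Nat.pos_of_mul_pos_right hk
    obtain ⟨e, he⟩ := Finset.card_pos.1 hpos
    exact ⟨e, (Finset.mem_filter.1 he).1, (Finset.mem_filter.1 he).2⟩
  · have h₁ : ∀ z, |(m x z : ℝ) - m y z| ≤
        |(c x z : ℝ) - c y z| * b x + c y z * |(b x : ℝ) - b y| := by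
      intro z
      have e : (m x z : ℝ) - m y z = ((c x z : ℝ) - c y z) * b x + c y z * ((b x : ℝ) - b y) := by
        simp only [m]
        push_cast
        ring
      rw [e]
      refine (abs_add_le _ _).trans ?_
      rw [abs_mul, abs_mul, Nat.abs_cast, Nat.abs_cast]
    have hDc : ∑ z, |(c x z : ℝ) - c y z| ≤ (symmDiff (A x) (A y)).card :=
      sum_abs_card_fiber_le Prod.fst _ _
    have hDa : |(a x : ℝ) - a y| ≤ (symmDiff (A x) (A y)).card := abs_card_sub_card_le _ _
    have hsum : ∑ z, |(m x z : ℝ) - m y z| ≤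
        (∑ z, |(c x z : ℝ) - c y z|) * b x + a y * |(b x : ℝ) - b y| := by
      refine (Finset.sum_le_sum fun z _ => h₁ z).trans ?_
      rw [Finset.sum_add_distrib, ← Finset.sum_mul, ← Finset.sum_mul, ← hc y]
      push_cast
      exact le_rfl
    have e₁ : (a x : ℝ) * b x = N := by exact_mod_cast hab x
    have e₂ : (a y : ℝ) * b y = N := by exact_mod_cast hab y
    -- Equal total mass `a x * b x = a y * b y` converts the change of multiplicity into the change
    -- of cardinality, which the symmetric difference controls.
    have e₃ : (a y : ℝ) * |(b x : ℝ) - b y| = |(a x : ℝ) - a y| * b x := by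
      have e : (a y : ℝ) * ((b x : ℝ) - b y) = -(((a x : ℝ) - a y) * b x) := by linarith
      have e' := congrArg abs e
      rwa [abs_neg, abs_mul, abs_mul, Nat.abs_cast, Nat.abs_cast] at e'
    have hi : ((A x ∩ A y).card : ℝ) ≤ a x := by
      exact_mod_cast Finset.card_le_card Finset.inter_subset_left
    have hb : (0 : ℝ) ≤ b x := Nat.cast_nonneg _
    have hD : ((symmDiff (A x) (A y)).card : ℝ) ≤ ε * a x :=
      (hA x y hxy).trans (mul_le_mul_of_nonneg_left hi hε.le)
    rw [e₃, ← add_mul] at hsum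
    calc _ ≤ _ := hsum
      _ ≤ (ε * a x + ε * a x) * b x := mul_le_mul_of_nonneg_right (by linarith) hb
      _ = 2 * ε * N := by rw [← e₁]; ring

/-- Consider the superlevel sets `{x ∈ U | k < m x z}` over all centres `z` and thresholds `k < N`.
Each vertex of `U` lies in exactly `N` of them, and an edge is separated by at most `2 * ε * N`.
Comparing the two weighted sums yields one set with small boundary, and it lies within distance `S`
of `z`. -/
theorem exists_small_boundary {V : Type*} [Fintype V] [DecidableEq V] {G : SimpleGraph V}
    {d S : ℕ} (hd : ∀ v, (G.neighborSet v).ncard ≤ d) {ε : ℝ} (hε : 0 < ε)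
    {A : V → Finset (V × ℕ)} (hne : ∀ x, (A x).Nonempty)
    (hS : ∀ x, ∀ a ∈ A x, G.edist x a.1 ≤ S)
    (hA : ∀ x y, G.Adj x y → ((symmDiff (A x) (A y)).card : ℝ) ≤ ε * (A x ∩ A y).card)
    {p : V → ℝ} (hp : ∀ v, 0 < p v) {U : Finset V} (hU : U.Nonempty) [DecidableRel G.Adj] :
    ∃ T ⊆ U, T.Nonempty ∧ (∃ z, ∀ x ∈ T, G.edist x z ≤ S) ∧
      ∑ x, ∑ y, (if x ∈ U ∧ y ∈ U ∧ G.Adj x y ∧ ¬ (x ∈ T ↔ y ∈ T) then p x else 0) ≤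
        2 * ε * d * ∑ x ∈ T, p x := by
  obtain ⟨N, m, hN, hm, hmA, hdiff⟩ := exists_rescaling hε hne hA
  have hmN : ∀ x z, m x z ≤ N := fun x z => by
    rw [← hm x]
    exact Finset.single_le_sum (f := m x) (fun _ _ => Nat.zero_le _) (Finset.mem_univ z)
  let T : V × ℕ → Finset V := fun e => U.filter fun x => e.2 < m x e.1
  let I : Finset (V × ℕ) := Finset.univ ×ˢ Finset.range N
  let bd : V × ℕ → ℝ := fun e =>
    ∑ x, ∑ y, if x ∈ U ∧ y ∈ U ∧ G.Adj x y ∧ ¬ (x ∈ T e ↔ y ∈ T e) then p x else 0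
  have hbd0 : ∀ e, 0 ≤ bd e := fun e => Finset.sum_nonneg fun x _ => Finset.sum_nonneg fun y _ => by
    have := (hp x).le
    split_ifs <;> simp [this]
  have hbd : ∑ e ∈ I, bd e ≤ 2 * ε * d * (N * ∑ x ∈ U, p x) := by
    have hxy : ∀ x y, ∑ e ∈ I, (if x ∈ U ∧ y ∈ U ∧ G.Adj x y ∧ ¬ (x ∈ T e ↔ y ∈ T e)
        then p x else 0) ≤ if x ∈ U ∧ G.Adj x y then p x * (2 * ε * N) else 0 := by
      intro x y
      by_cases h : x ∈ U ∧ y ∈ U ∧ G.Adj x y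
      · obtain ⟨hx, hy, hadj⟩ := h
        rw [if_pos ⟨hx, hadj⟩, Finset.sum_product]
        refine le_trans ?_ (mul_le_mul_of_nonneg_left (hdiff x y hadj) (hp x).le)
        rw [Finset.mul_sum]
        refine Finset.sum_le_sum fun z _ => ?_
        simp only [hx, hy, hadj, true_and, T, Finset.mem_filter]
        rw [← Finset.sum_filter, Finset.sum_const, nsmul_eq_mul, mul_comm]
        exact mul_le_mul_of_nonneg_left (card_separating_le N _ _) (hp x).le
      · rw [Finset.sum_eq_zero fun e _ => if_neg fun h' => h ⟨h'.1, h'.2.1, h'.2.2.1⟩]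
        have : 0 ≤ p x * (2 * ε * N) := mul_nonneg (hp x).le (by positivity)
        split_ifs <;> simp [this]
    simp only [bd]
    rw [Finset.sum_comm]
    have hx : ∀ x, ∑ e ∈ I, ∑ y, (if x ∈ U ∧ y ∈ U ∧ G.Adj x y ∧ ¬ (x ∈ T e ↔ y ∈ T e)
        then p x else 0) ≤ if x ∈ U then d * (p x * (2 * ε * N)) else 0 := by
      intro x
      rw [Finset.sum_comm]
      refine (Finset.sum_le_sum fun y _ => hxy x y).trans ?_
      by_cases h : x ∈ U
      · simp only [h, true_and, if_true]
        exact sum_adj_le hd (F := G.Adj) (fun _ _ h => h) x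
          (mul_nonneg (hp x).le (by positivity))
      · simp [h]
    refine (Finset.sum_le_sum fun x _ => hx x).trans (le_of_eq ?_)
    rw [← Finset.sum_filter, Finset.filter_mem_eq_inter, Finset.univ_inter, ← Finset.mul_sum,
      ← Finset.sum_mul]
    ring
  have hT : ∑ e ∈ I, ∑ x ∈ T e, p x = N * ∑ x ∈ U, p x := by
    simp only [T, Finset.sum_filter]
    rw [Finset.sum_comm, Finset.mul_sum]
    refine Finset.sum_congr rfl fun x _ => ?_
    have hNx : (N : ℝ) = ∑ z, (m x z : ℝ) := by exact_mod_cast (hm x).symm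
    rw [Finset.sum_product, hNx, Finset.sum_mul]
    refine Finset.sum_congr rfl fun z _ => ?_
    rw [← Finset.sum_filter, Finset.sum_const, nsmul_eq_mul]
    congr 2
    have : ((Finset.range N).filter fun k => k < m x z) = Finset.range (m x z) := by
      ext k
      have := hmN x z
      simp only [Finset.mem_filter, Finset.mem_range]
      omega
    rw [this, Finset.card_range]
  obtain ⟨x₀, hx₀⟩ := hU
  obtain ⟨z₀, hz₀⟩ : ∃ z, 0 < m x₀ z := by
    by_contra! h
    have := hm x₀
    rw [Finset.sum_eq_zero fun z _ => Nat.le_zero.1 (h z)] at this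
    omega
  -- Restricting to nonempty superlevel sets is harmless: empty ones contribute nothing to the
  -- right-hand sum.
  obtain ⟨⟨z, k⟩, he, hle⟩ := Finset.exists_le_of_sum_le (s := I.filter fun e => (T e).Nonempty)
    (f := bd) (g := fun e => 2 * ε * d * ∑ x ∈ T e, p x)
    ⟨(z₀, 0), by
      simp only [I, Finset.mem_filter, Finset.mem_product, Finset.mem_univ, Finset.mem_range,
        true_and]
      exact ⟨hN, x₀, by simp [T, hx₀, hz₀]⟩⟩ (by
    refine (Finset.sum_le_sum_of_subset_of_nonneg (Finset.filter_subset _ _)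
      fun e _ _ => hbd0 e).trans (hbd.trans (le_of_eq ?_))
    rw [← hT, Finset.mul_sum]
    refine (Finset.sum_filter_of_ne fun e _ hne => ?_).symm
    by_contra hemp
    rw [Finset.not_nonempty_iff_eq_empty] at hemp
    simp [hemp] at hne)
  refine ⟨T (z, k), Finset.filter_subset _ _, (Finset.mem_filter.1 he).2, ⟨z, fun x hx => ?_⟩, hle⟩
  obtain ⟨e, heA, rfl⟩ := hmA x z (Nat.zero_lt_of_lt (Finset.mem_filter.1 hx).2)
  exact hS x e heA

/-- Peel off one set of small boundary at a time. Edges between `T` and the rest of `U` are charged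
to the weight of `T`; edges within the rest are handled by induction. -/
theorem exists_clustering {V : Type*} [Fintype V] [DecidableEq V] {G : SimpleGraph V}
    {d S : ℕ} (hd : ∀ v, (G.neighborSet v).ncard ≤ d) {ε : ℝ} (hε : 0 < ε)
    {A : V → Finset (V × ℕ)} (hne : ∀ x, (A x).Nonempty)
    (hS : ∀ x, ∀ a ∈ A x, G.edist x a.1 ≤ S)
    (hA : ∀ x y, G.Adj x y → ((symmDiff (A x) (A y)).card : ℝ) ≤ ε * (A x ∩ A y).card)
    {p : V → ℝ} (hp : ∀ v, 0 < p v) [DecidableRel G.Adj] (U : Finset V) :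
    ∃ c : V → ℕ, (∀ x ∈ U, ∀ y ∈ U, c x = c y → G.edist x y ≤ (2 * S : ℕ)) ∧
      ∑ x, ∑ y, (if x ∈ U ∧ y ∈ U ∧ G.Adj x y ∧ c x ≠ c y then p x else 0) ≤
        2 * ε * d * ∑ x ∈ U, p x := by
  induction U using Finset.strongInduction with
  | H U ih =>
    rcases U.eq_empty_or_nonempty with rfl | hU
    · exact ⟨fun _ => 0, by simp, by simp⟩
    obtain ⟨T, hTU, hTne, ⟨z, hz⟩, hT⟩ := exists_small_boundary hd hε hne hS hA hp hU
    obtain ⟨c, hc, hcw⟩ := ih (U \ T) (Finset.sdiff_ssubset hTU hTne)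
    refine ⟨fun x => if x ∈ T then 0 else c x + 1, fun x hx y hy hxy => ?_, ?_⟩
    · by_cases hxT : x ∈ T <;> by_cases hyT : y ∈ T <;> simp [hxT, hyT] at hxy
      · have h₁ := hz x hxT
        have h₂ := hz y hyT
        rw [SimpleGraph.edist_comm] at h₂
        refine SimpleGraph.edist_triangle.trans ((add_le_add h₁ h₂).trans ?_)
        rw [two_mul]
        push_cast
        exact le_rfl
      · exact hc x (Finset.mem_sdiff.2 ⟨hx, hxT⟩) y (Finset.mem_sdiff.2 ⟨hy, hyT⟩) hxy
    · rw [← Finset.sum_sdiff hTU, mul_add]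
      refine le_trans ?_ (add_le_add hcw hT)
      simp only [← Finset.sum_add_distrib]
      refine Finset.sum_le_sum fun x _ => Finset.sum_le_sum fun y _ => ?_
      have hx := hp x
      by_cases h : x ∈ U ∧ y ∈ U ∧ G.Adj x y
      · obtain ⟨h₁, h₂, h₃⟩ := h
        by_cases hxT : x ∈ T <;> by_cases hyT : y ∈ T <;>
          simp [h₁, h₂, h₃, hxT, hyT]
      · rw [if_neg fun h' => h ⟨h'.1, h'.2.1, h'.2.2.1⟩]
        split_ifs <;> linarith

theorem HasPropertyA.isHyperfinite {d : ℕ} {𝒢 : Set (FiniteGraph d)} (h : HasPropertyA 𝒢) :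
    IsHyperfinite 𝒢 := by
  classical
  intro ε hε
  have hd : (0 : ℝ) < 2 * (d + 1) := by positivity
  -- The factor `2 * d` of the clustering bound is absorbed here; `d + 1` avoids division by zero.
  obtain ⟨S, hS⟩ := h (ε / (2 * (d + 1))) (by positivity) 1
  refine ⟨2 * S, fun G hG p hp => ?_⟩
  obtain ⟨A, hne, hAS, hA⟩ := hS G hG
  obtain ⟨c, hc, hcw⟩ := exists_clustering G.degree_le
    (ε := ε / (2 * (d + 1))) (by positivity) hne hAS
    (fun x y hxy => (hA x y (by
      rw [SimpleGraph.edist_eq_one_iff_adj.2 hxy]; exact le_rfl)).le) hp Finset.univ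
  let H : SimpleGraph G.V :=
    { Adj := fun x y => G.graph.Adj x y ∧ c x = c y
      symm := ⟨fun _ _ h => ⟨h.1.symm, h.2.symm⟩⟩
      loopless := ⟨fun _ h => G.graph.loopless.irrefl _ h.1⟩ }
  have hH : ∀ x y, H.Reachable x y → c x = c y := by
    intro x y hxy
    rw [SimpleGraph.reachable_iff_reflTransGen] at hxy
    induction hxy with
    | refl => rfl
    | tail _ hbc ih => exact ih.trans hbc.2
  refine ⟨H, fun _ _ h => h.1, fun x y hxy =>
    hc x (Finset.mem_univ _) y (Finset.mem_univ _) (hH x y hxy), ?_⟩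
  have hle : 2 * (ε / (2 * (d + 1))) * d ≤ ε := by
    rw [mul_div_assoc', div_mul_eq_mul_div, div_le_iff₀ hd]
    nlinarith
  refine le_trans (le_of_eq ?_) (hcw.trans
    (mul_le_mul_of_nonneg_right hle (Finset.sum_nonneg fun v _ => (hp v).le)))
  refine Finset.sum_congr rfl fun x _ => Finset.sum_congr rfl fun y _ => ?_
  congr 1
  simp only [Finset.mem_univ, true_and, H]
  exact propext ⟨fun h => ⟨h.1, fun h' => h.2 ⟨h.1, h'⟩⟩, fun h => ⟨h.1, fun h' => h.2 h'.2⟩⟩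

/-! ### Hyperfinite classes and reasonable properties -/

/-- `F` is, up to isomorphism, a subgraph of a member of `P`. -/
def IsSubgraphOfMember {d : ℕ} (P : Set (FiniteGraph d)) {V : Type*} (F : SimpleGraph V) : Prop :=
  ∃ G ∈ P, F.IsContained G.graph

theorem IsReasonable.mem_of_isSubgraphOfMember {d : ℕ} {P : Set (FiniteGraph d)}
    (hP : IsReasonable P) {G : FiniteGraph d} (h : IsSubgraphOfMember P G.graph) : G ∈ P := by
  obtain ⟨F, hF, hGF⟩ := h
  exact hP.subgraph F G hF hGF

theorem IsSubgraphOfMember.mono {d : ℕ} {P : Set (FiniteGraph d)} {V W : Type*}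
    {F : SimpleGraph V} {F' : SimpleGraph W} (h : IsSubgraphOfMember P F')
    (hF : F.IsContained F') : IsSubgraphOfMember P F := by
  obtain ⟨G, hG, hGF⟩ := h
  exact ⟨G, hG, hF.trans hGF⟩

/-- The disjoint union of two graphs of degree at most `d`. -/
def FiniteGraph.disjSum {d : ℕ} (G₁ G₂ : FiniteGraph d) : FiniteGraph d where
  V := G₁.V ⊕ G₂.V
  graph := G₁.graph.sum G₂.graph
  degree_le := by
    rintro (v | v)
    · have : (G₁.graph.sum G₂.graph).neighborSet (Sum.inl v) =
          Sum.inl '' G₁.graph.neighborSet v := by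
        ext (w | w) <;> simp
      rw [this, Set.ncard_image_of_injective _ Sum.inl_injective]
      exact G₁.degree_le v
    · have : (G₁.graph.sum G₂.graph).neighborSet (Sum.inr v) =
          Sum.inr '' G₂.graph.neighborSet v := by
        ext (w | w) <;> simp
      rw [this, Set.ncard_image_of_injective _ Sum.inr_injective]
      exact G₂.degree_le v

/-- Embed the two pieces into the two summands of a disjoint union; no edge runs between them. -/
theorem IsReasonable.isSubgraphOfMember_of_partition {d : ℕ} {P : Set (FiniteGraph d)}
    (hP : IsReasonable P) {V : Type*} {F : SimpleGraph V} (S T : Set V)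
    (hST : ∀ x ∈ S, ∀ y ∈ T, ¬ F.Adj x y) (hS : IsSubgraphOfMember P (F.induce S))
    (hT : IsSubgraphOfMember P (F.induce T)) : IsSubgraphOfMember P (F.induce (S ∪ T)) := by
  classical
  obtain ⟨G₁, hG₁, ⟨f⟩⟩ := hS
  obtain ⟨G₂, hG₂, ⟨g⟩⟩ := hT
  refine ⟨G₁.disjSum G₂, hP.disjUnion G₁ G₂ _ hG₁ hG₂ ⟨SimpleGraph.Iso.refl⟩, ?_⟩
  let φ : (S ∪ T : Set V) → G₁.V ⊕ G₂.V := fun v =>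
    if h : v.1 ∈ S then Sum.inl (f ⟨v, h⟩) else Sum.inr (g ⟨v, v.2.resolve_left h⟩)
  refine ⟨⟨⟨φ, ?_⟩, ?_⟩⟩
  · rintro ⟨x, hx⟩ ⟨y, hy⟩ hxy
    have hxy' : F.Adj x y := hxy
    change (G₁.graph.sum G₂.graph).Adj (φ ⟨x, hx⟩) (φ ⟨y, hy⟩)
    by_cases hxS : x ∈ S <;> by_cases hyS : y ∈ S
    · simp only [φ, hxS, hyS, dif_pos, SimpleGraph.sum_adj_inl]
      exact f.toHom.map_adj (show (F.induce S).Adj ⟨x, hxS⟩ ⟨y, hyS⟩ from hxy')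
    · exact absurd hxy' (hST x hxS y (hy.resolve_left hyS))
    · exact absurd hxy'.symm (hST y hyS x (hx.resolve_left hxS))
    · simp only [φ, hxS, hyS, dif_neg, not_false_eq_true, SimpleGraph.sum_adj_inr]
      exact g.toHom.map_adj (show (F.induce T).Adj ⟨x, hx.resolve_left hxS⟩
        ⟨y, hy.resolve_left hyS⟩ from hxy')
  · rintro ⟨x, hx⟩ ⟨y, hy⟩ hxy
    change φ ⟨x, hx⟩ = φ ⟨y, hy⟩ at hxy
    by_cases hxS : x ∈ S <;> by_cases hyS : y ∈ S <;> simp only [φ, hxS, hyS, dif_pos, dif_neg,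
      not_false_eq_true, Sum.inl.injEq, Sum.inr.injEq, reduceCtorEq] at hxy
    · exact Subtype.ext (by simpa using f.injective hxy)
    · exact Subtype.ext (by simpa using g.injective hxy)

/-- A finite graph all of whose components are subgraphs of members of `P` is one as well. -/
theorem IsReasonable.isSubgraphOfMember_of_components {d : ℕ} {P : Set (FiniteGraph d)}
    (hP : IsReasonable P) (hne : P.Nonempty) {V : Type*} [Finite V] {F : SimpleGraph V}
    (h : ∀ x, IsSubgraphOfMember P (F.induce {y | F.Reachable x y})) :
    IsSubgraphOfMember P F := by
  classical
  have := Fintype.ofFinite V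
  suffices hs : ∀ s : Finset V,
      IsSubgraphOfMember P (F.induce {y | ∃ x ∈ s, F.Reachable x y}) by
    refine (hs Finset.univ).mono ⟨⟨⟨fun v => ⟨v, v, Finset.mem_univ v, .refl _⟩, ?_⟩, ?_⟩⟩
    · exact fun hxy => hxy
    · exact fun x y hxy => congrArg Subtype.val hxy
  intro s
  induction s using Finset.induction_on with
  | empty =>
    obtain ⟨G, hG⟩ := hne
    have : IsEmpty {y | ∃ x ∈ (∅ : Finset V), F.Reachable x y} := ⟨fun y => by
      obtain ⟨_, _, hx, _⟩ := y
      simp at hx⟩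
    exact ⟨G, hG, SimpleGraph.IsContained.of_isEmpty⟩
  | insert a s ha ih =>
    by_cases hex : ∃ x ∈ s, F.Reachable x a
    · have e : {y | ∃ x ∈ insert a s, F.Reachable x y} = {y | ∃ x ∈ s, F.Reachable x y} := by
        ext y
        constructor
        · rintro ⟨x, hx, hxy⟩
          rcases Finset.mem_insert.1 hx with rfl | hx
          · obtain ⟨z, hz, hza⟩ := hex
            exact ⟨z, hz, hza.trans hxy⟩
          · exact ⟨x, hx, hxy⟩
        · rintro ⟨x, hx, hxy⟩
          exact ⟨x, Finset.mem_insert_of_mem hx, hxy⟩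
      rwa [e]
    · have e : {y | ∃ x ∈ insert a s, F.Reachable x y} =
          {y | F.Reachable a y} ∪ {y | ∃ x ∈ s, F.Reachable x y} := by
        ext y
        simp
      rw [e]
      refine hP.isSubgraphOfMember_of_partition _ _ (fun x hx y hy hxy => hex ?_) (h a) ih
      obtain ⟨z, hz, hzy⟩ := hy
      exact ⟨z, hz, hzy.trans (hxy.symm.reachable.trans (SimpleGraph.Reachable.symm hx))⟩

/-- The ball of radius `r` around `x`, as an induced subgraph. -/
abbrev ballGraph {V : Type*} (G : SimpleGraph V) (r : ℕ) (x : V) :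
    SimpleGraph {y : V | G.edist x y ≤ r} :=
  G.induce {y : V | G.edist x y ≤ r}

open scoped Classical in
theorem editDist_of_le {V : Type} [Fintype V] {G H : SimpleGraph V} (hHG : H ≤ G) {p : V → ℝ} :
    editDist G p H p = cutWeight G H p := by
  have h₂ : (Finset.univ.filter fun f : Sym2 V => f ∈ H.edgeSet \ G.edgeSet) = ∅ := by
    refine Finset.filter_eq_empty_iff.2 fun f _ hf => hf.2 ?_
    exact SimpleGraph.edgeSet_mono hHG hf.1
  -- Splitting an edge weight over its two distinct endpoints and exchanging the sums gives the
  -- ordered pairs counted by `cutWeight`.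
  have hw : ∀ e : Sym2 V, ¬ e.IsDiag →
      edgeWeight p e = ∑ x, if x ∈ e then p x else 0 := by
    intro e
    induction e with
    | h u v =>
      intro huv
      have huv' : u ≠ v := fun h => huv (by simpa using h)
      rw [← Finset.sum_filter]
      have : (Finset.univ.filter fun x => x ∈ s(u, v)) = {u, v} := by
        ext x
        simp
      rw [this, Finset.sum_pair huv']
      rfl
  rw [editDist, h₂, Finset.sum_empty, add_zero, cutWeight]
  rw [Finset.sum_congr rfl fun e he => hw e
    (G.not_isDiag_of_mem_edgeSet (Finset.mem_filter.1 he).2.1), Finset.sum_comm]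
  refine Finset.sum_congr rfl fun x _ => ?_
  rw [← Finset.sum_filter, ← Finset.sum_filter, Finset.sum_const, Finset.sum_const,
    Finset.filter_filter]
  congr 1
  symm
  refine Finset.card_bij (fun y _ => s(x, y)) (fun y hy => ?_) (fun y _ y' _ h => ?_)
    fun e he => ?_
  · simpa using hy
  · exact Sym2.congr_right.1 h
  · obtain ⟨-, he, hx⟩ := Finset.mem_filter.1 he
    obtain ⟨y, rfl⟩ := hx
    exact ⟨y, by simpa using he, rfl⟩

/-- If the graphs are hyperfinite, then a graph far from a reasonable property has many vertices
whose balls do not occur in members of the property. -/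
theorem IsHyperfinite.exists_ball_bound {d : ℕ} {𝒢 P : Set (FiniteGraph d)}
    (h𝒢 : IsHyperfinite 𝒢) (hP : IsReasonable P) {ε : ℝ} (hε : 0 < ε) :
    ∃ r : ℕ, 0 < r ∧ ∀ (K : ℝ), ∀ G ∈ 𝒢, ∀ p : G.V → ℝ, IsKWeighting G.graph K p →
      ENNReal.ofReal ε < distToProperty K G p P →
      ∀ bad : Finset G.V, (∀ x, x ∉ bad → IsSubgraphOfMember P (ballGraph G.graph r x)) →
        min 1 (ε / (2 * (d + 1))) ≤ ∑ x ∈ bad, p x := by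
  classical
  obtain ⟨D, hD⟩ := h𝒢 (ε / 2) (by positivity)
  refine ⟨D + 1, Nat.succ_pos _, fun K G hG p hp hdist bad hbad => ?_⟩
  obtain ⟨H, hHG, hHD, hHw⟩ := hD G hG p hp.pos
  rw [hp.sum_eq_one, mul_one] at hHw
  -- If every vertex is bad, the bad weight is `1`, whence the minimum with `1`. Otherwise a good
  -- vertex shows that `P` is nonempty.
  by_cases hall : ∀ x, x ∈ bad
  · refine (min_le_left _ _).trans ?_
    rw [← hp.sum_eq_one]
    exact (Finset.sum_le_sum_of_subset_of_nonneg (fun x _ => hall x) fun x _ _ => (hp.pos x).le)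
  push Not at hall
  obtain ⟨x₀, hx₀⟩ := hall
  refine (min_le_right _ _).trans ?_
  by_contra! hlt
  -- Keep the components of `H` that contain a good vertex and dissolve the others into isolated
  -- vertices.
  let H' : SimpleGraph G.V :=
    { Adj := fun x y => H.Adj x y ∧ ∃ z, H.Reachable x z ∧ z ∉ bad
      symm := ⟨fun x y h => ⟨h.1.symm, by
        obtain ⟨h₁, z, hz, hzb⟩ := h
        exact ⟨z, h₁.symm.reachable.trans hz, hzb⟩⟩⟩
      loopless := ⟨fun _ h => H.loopless.irrefl _ h.1⟩ }
  have hH'H : H' ≤ H := fun _ _ h => h.1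
  have hH'G : H' ≤ G.graph := hH'H.trans hHG
  have hdeg : ∀ v, (H'.neighborSet v).ncard ≤ d := fun v =>
    (Set.ncard_le_ncard (fun w hw => hH'G hw) (Set.toFinite _)).trans (G.degree_le v)
  have hmem : (⟨G.V, H', hdeg⟩ : FiniteGraph d) ∈ P := by
    refine hP.mem_of_isSubgraphOfMember (hP.isSubgraphOfMember_of_components ?_ fun x => ?_)
    · obtain ⟨F, hF, -⟩ := hbad x₀ hx₀
      exact ⟨F, hF⟩
    by_cases hx : ∃ z, H.Reachable x z ∧ z ∉ bad
    · obtain ⟨z, hxz, hz⟩ := hx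
      refine (hbad z hz).mono ⟨⟨⟨fun y => ⟨y.1, ?_⟩, fun {a b} hab => hH'G hab⟩, ?_⟩⟩
      · exact (hHD z y.1 (hxz.symm.trans (SimpleGraph.Reachable.mono hH'H y.2))).trans
          (by exact_mod_cast Nat.le_succ D)
      · exact fun a b hab => Subtype.ext (congrArg (fun y => y.1) hab)
    · have hone : ∀ y, H'.Reachable x y → y = x := by
        intro y hy
        rw [SimpleGraph.reachable_iff_reflTransGen] at hy
        induction hy with
        | refl => rfl
        | tail _ hbc ih => exact absurd (ih ▸ hbc.2) hx
      refine (hbad x₀ hx₀).mono ⟨⟨⟨fun _ => ⟨x₀, by simp⟩, fun {a b} hab => ?_⟩, ?_⟩⟩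
      · refine absurd ((hone a a.2).trans (hone b b.2).symm) ?_
        exact (show H'.Adj a.1 b.1 from hab).ne
      · exact fun a b _ => Subtype.ext ((hone a a.2).trans (hone b b.2).symm)
  have hKp : IsKWeighting H' K p := ⟨hp.pos, hp.sum_eq_one, fun v w h => hp.ratio v w (hH'G h)⟩
  -- An edge of `H` is dropped only when its whole component is bad, so each bad vertex pays for at
  -- most `d` edges.
  have hcut : cutWeight H H' p ≤ d * ∑ x ∈ bad, p x := by
    rw [Finset.mul_sum, ← Finset.univ_inter bad, ← Finset.filter_mem_eq_inter, Finset.sum_filter]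
    refine Finset.sum_le_sum fun x _ => ?_
    by_cases hx : x ∈ bad
    · rw [if_pos hx]
      refine le_trans (le_of_eq (Finset.sum_congr rfl fun y _ => ?_))
        (sum_adj_le G.degree_le (F := fun x y => H.Adj x y ∧ ¬ H'.Adj x y)
          (fun x y h => hHG h.1) x (hp.pos x).le)
      congr
    · rw [if_neg hx]
      refine (Finset.sum_eq_zero fun y _ => if_neg fun h => h.2 ⟨h.1, x, .refl _, hx⟩).le
  have hle : distToProperty K G p P ≤ ENNReal.ofReal ε := by
    have hle' : distToProperty K G p P ≤ ENNReal.ofReal (editDist G.graph p H' p) :=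
      iInf_le_of_le H' (iInf_le_of_le hdeg (iInf_le_of_le hmem (iInf_le_of_le p
        (iInf_le_of_le hKp le_rfl))))
    refine hle'.trans (ENNReal.ofReal_le_ofReal ?_)
    rw [editDist_of_le hH'G]
    refine (cutWeight_triangle _ H _ hp.pos).trans ?_
    have h₀ : 0 ≤ ∑ x ∈ bad, p x := Finset.sum_nonneg fun x _ => (hp.pos x).le
    rw [lt_div_iff₀ (by positivity)] at hlt
    nlinarith
  exact absurd hdist (not_lt.2 hle)

/-! ### The tester -/

theorem SimpleGraph.exists_walk_length_le {V : Type*} {G : SimpleGraph V} {x y : V} {r : ℕ}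
    (h : G.edist x y ≤ r) : ∃ w : G.Walk x y, w.length ≤ r := by
  obtain ⟨w, hw⟩ := SimpleGraph.exists_walk_of_edist_ne_top
    (ne_top_of_le_ne_top (ENat.natCast_ne_top r) h)
  rw [← hw] at h
  exact ⟨w, by exact_mod_cast h⟩

open scoped Classical in
theorem card_ball_le {V : Type*} [Fintype V] {G : SimpleGraph V} {d : ℕ}
    (hd : ∀ v, (G.neighborSet v).ncard ≤ d) (r : ℕ) (x : V) :
    (Finset.univ.filter fun y => G.edist x y ≤ r).card ≤ (d + 1) ^ r := by
  induction r generalizing x with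
  | zero =>
    refine Finset.card_le_one.2 fun a ha b hb => ?_
    simp only [Nat.cast_zero, nonpos_iff_eq_zero, SimpleGraph.edist_eq_zero_iff,
      Finset.mem_filter, Finset.mem_univ, true_and] at ha hb
    exact ha.symm.trans hb
  | succ r ih =>
    have hsub : (Finset.univ.filter fun y => G.edist x y ≤ (r + 1 : ℕ)) ⊆
        (insert x (G.neighborFinset x)).biUnion fun z =>
          Finset.univ.filter fun y => G.edist z y ≤ r := by
      intro y hy
      obtain ⟨w, hw⟩ := SimpleGraph.exists_walk_length_le (Finset.mem_filter.1 hy).2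
      simp only [Finset.mem_biUnion, Finset.mem_filter, Finset.mem_univ, true_and]
      cases w with
      | nil => exact ⟨x, Finset.mem_insert_self _ _, by simp⟩
      | @cons _ z _ hxz q =>
        refine ⟨z, Finset.mem_insert_of_mem (by simpa using hxz),
          (SimpleGraph.edist_le q).trans ?_⟩
        rw [SimpleGraph.Walk.length_cons] at hw
        exact_mod_cast (by omega : q.length ≤ r)
    refine (Finset.card_le_card hsub).trans
      ((Finset.card_biUnion_le_card_mul _ _ _ fun z _ => ih z).trans ?_)
    rw [pow_succ']
    refine Nat.mul_le_mul_right _ ((Finset.card_insert_le _ _).trans ?_)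
    have := hd x
    rw [← SimpleGraph.coe_neighborFinset, Set.ncard_coe_finset] at this
    omega

/-- The maximum with `1` makes the bound monotone in the length, also for `K < 1`. -/
theorem IsKWeighting.le_of_walk {V : Type} [Fintype V] {G : SimpleGraph V} {K : ℝ} {p : V → ℝ}
    (hp : IsKWeighting G K p) {x y : V} (w : G.Walk x y) : p y ≤ max K 1 ^ w.length * p x := by
  induction w with
  | nil => simp
  | @cons u v w huv q ih =>
    have h₁ := (hp.ratio v u huv.symm).2
    rw [div_le_iff₀ (hp.pos u)] at h₁
    have h₂ : p v ≤ max K 1 * p u :=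
      h₁.trans (mul_le_mul_of_nonneg_right (le_max_left _ _) (hp.pos u).le)
    rw [SimpleGraph.Walk.length_cons, pow_succ, mul_assoc]
    exact ih.trans (mul_le_mul_of_nonneg_left h₂ (by positivity))

theorem IsKWeighting.label_le {V : Type} [Fintype V] {G : SimpleGraph V} {K : ℝ} {p : V → ℝ}
    (hp : IsKWeighting G K p) {x y : V} {r : ℕ} (h : G.edist x y ≤ r) (t : ℕ) :
    ⌊(10 : ℝ) ^ t * (p y / p x)⌋₊ ≤ ⌊(10 : ℝ) ^ t * max K 1 ^ r⌋₊ := by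
  obtain ⟨w, hw⟩ := SimpleGraph.exists_walk_length_le h
  refine Nat.floor_mono (mul_le_mul_of_nonneg_left ?_ (by positivity))
  rw [div_le_iff₀ (hp.pos x)]
  exact (hp.le_of_walk w).trans (mul_le_mul_of_nonneg_right
    (pow_le_pow_right₀ (le_max_right _ _) hw) (hp.pos x).le)

theorem oracleBalls_finite (d r : ℕ) (K : ℝ) (t : ℕ) : (oracleBalls d r K t).Finite := by
  classical
  let N := (d + 1) ^ r
  let M := ⌊(10 : ℝ) ^ t * max K 1 ^ r⌋₊
  let ι := Σ n : Fin (N + 1), SimpleGraph (Fin n) × Fin n × (Fin n → Fin (M + 1))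
  let Φ : ι → RootedLabelledClass := fun c =>
    Quotient.mk _ ⟨Fin c.1, c.2.1, c.2.2.1, fun v => c.2.2.2 v⟩
  refine (Set.finite_range Φ).subset ?_
  rintro _ ⟨G, p, hp, x, rfl⟩
  let W := {y : G.V // G.graph.edist x y ≤ r}
  have hcard : Fintype.card W ≤ N := by
    rw [Fintype.card_subtype]
    exact card_ball_le G.degree_le r x
  let e : W ≃ Fin (Fintype.card W) := Fintype.equivFin W
  let B := labelledBall G.graph p r t x
  refine ⟨⟨⟨Fintype.card W, Nat.lt_succ_of_le hcard⟩, B.graph.comap e.symm, e B.root,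
    fun v => ⟨B.label (e.symm v), Nat.lt_succ_of_le (hp.label_le (e.symm v).2 t)⟩⟩, ?_⟩
  refine Quotient.sound ⟨SimpleGraph.Iso.comap e.symm B.graph, ?_, fun v => rfl⟩
  exact e.symm_apply_apply _

/-- The complement of the event is contained in the event that all samples avoid `bad`, whose
probability factors. -/
theorem lt_sampleProb {V : Type} [Fintype V] {p : V → ℝ} (hp1 : ∑ v, p v = 1)
    {C : ℕ} {E : (Fin C → V) → Prop} (hp : ∀ v, 0 < p v) (bad : Finset V)
    (hE : ∀ x, (∃ i, x i ∈ bad) → E x) : 1 - (1 - ∑ x ∈ bad, p x) ^ C ≤ sampleProb p E := by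
  classical
  have hgood : ∑ x ∈ Finset.univ \ bad, p x = 1 - ∑ x ∈ bad, p x := by
    rw [← hp1, ← Finset.sum_sdiff (Finset.subset_univ bad)]
    ring
  have htot : ∑ x : Fin C → V, ∏ i, p (x i) = 1 := by
    have := Finset.prod_univ_sum (fun _ : Fin C => (Finset.univ : Finset V)) (fun _ v => p v)
    simp only [hp1, Finset.prod_const_one, Fintype.piFinset_univ] at this
    exact this.symm
  have hall : ∑ x ∈ Fintype.piFinset fun _ : Fin C => Finset.univ \ bad, ∏ i, p (x i) =
      (1 - ∑ x ∈ bad, p x) ^ C := by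
    rw [← hgood, ← Finset.prod_univ_sum (fun _ : Fin C => Finset.univ \ bad) (fun _ v => p v)]
    simp
  rw [sampleProb, ← hall, sub_le_iff_le_add, ← htot]
  rw [← Finset.sum_filter_add_sum_filter_not Finset.univ E]
  refine add_le_add (by convert le_rfl) ?_
  refine Finset.sum_le_sum_of_subset_of_nonneg (fun x hx => ?_)
    fun x _ _ => Finset.prod_nonneg fun i _ => (hp _).le
  rw [Fintype.mem_piFinset]
  intro i
  simp only [Finset.mem_sdiff, Finset.mem_univ, true_and]
  exact fun h => (Finset.mem_filter.1 hx).2 (hE x ⟨i, h⟩)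

theorem IsHyperfinite.isTestable {d : ℕ} {𝒢 P : Set (FiniteGraph d)} (h𝒢 : IsHyperfinite 𝒢)
    (hP : IsReasonable P) : IsTestable 𝒢 P := by
  classical
  intro ε hε K _
  obtain ⟨r, hr, hball⟩ := h𝒢.exists_ball_bound hP hε
  set δ := min 1 (ε / (2 * (d + 1)))
  have hδ : 0 < δ := lt_min one_pos (by positivity)
  have hδ1 : δ ≤ 1 := min_le_left _ _
  obtain ⟨C, hC⟩ := exists_pow_lt_of_lt_one hε (by linarith : 1 - δ < 1)
  let good : RootedLabelledClass → Prop := fun c =>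
    ∃ B : RootedLabelledGraph, Quotient.mk _ B = c ∧ IsSubgraphOfMember P B.graph
  -- The rule forgets root and labels, so depth `1` suffices; `C + 1` merely makes the number of
  -- queries positive.
  refine ⟨1, r, C + 1, one_pos, hr, C.succ_pos, oracleBalls_finite d r K 1,
    fun c => ∀ i, good (c i), fun G hG p hp => ⟨fun hGP x i => ?_, fun hdist => ?_⟩⟩
  · exact ⟨_, rfl, G, hGP, ⟨⟨SimpleGraph.Hom.comap _ _, Subtype.val_injective⟩⟩⟩
  · let bad : Finset G.V :=
      Finset.univ.filter fun x => ¬ IsSubgraphOfMember P (ballGraph G.graph r x)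
    have hbad : δ ≤ ∑ x ∈ bad, p x := hball K G hG p hp hdist bad fun x hx => by
      by_contra h
      exact hx (Finset.mem_filter.2 ⟨Finset.mem_univ x, h⟩)
    have hbad1 : ∑ x ∈ bad, p x ≤ 1 := by
      rw [← hp.sum_eq_one]
      exact Finset.sum_le_sum_of_subset_of_nonneg (Finset.subset_univ _)
        fun x _ _ => (hp.pos x).le
    refine lt_of_lt_of_le ?_ (lt_sampleProb hp.sum_eq_one hp.pos bad ?_)
    · have h₁ : (1 - ∑ x ∈ bad, p x) ^ (C + 1) ≤ (1 - δ) ^ (C + 1) :=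
        pow_le_pow_left₀ (by linarith) (by linarith) _
      have h₂ : (1 - δ) ^ (C + 1) ≤ (1 - δ) ^ C :=
        pow_le_pow_of_le_one (by linarith) (by linarith) (Nat.le_succ C)
      linarith
    · rintro x ⟨i, hi⟩ hacc
      obtain ⟨B, hB, hBP⟩ := hacc i
      obtain ⟨φ, -, -⟩ : B.Isomorphic (labelledBall G.graph p r 1 (x i)) := Quotient.exact hB
      exact (Finset.mem_filter.1 hi).2 (hBP.mono ⟨φ.symm.toCopy⟩)

theorem mainTheorem1 (d : ℕ) (P : Set (FiniteGraph d)) (hP : IsReasonable P) :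
    IsTestable (planarGraphs d) P ∧
      ∀ 𝒢 : Set (FiniteGraph d), HasPropertyA 𝒢 → IsTestable 𝒢 P :=
  ⟨(isHyperfinite_planarGraphs d).isTestable hP, fun _ h𝒢 => h𝒢.isHyperfinite.isTestable hP⟩
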